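/- Let $\Phi$ be an irreducible reduced crystallographic finite root system of rank $n\ge 1$ in a real vector space $V$, with simple roots $\Pi=\{\alpha_i : i\in I\}$, Cartan matrix $a_{ij}=\langle\alpha_i^\vee,\alpha_j\rangle$ and positive roots $\Phi_{>0}$. Let $h$ be its Coxeter number (the order of any Coxeter element, i.e. of any product of all simple reflections, each taken once, in some order), and let $w_\circ$ be the longest element of its Weyl group. Put $\Phi_{\ge -1}=\Phi_{>0}\cup(-\Pi)$. The Coxeter graph on $I$, in which $i\ne j$ are joined iff $a_{ij}a_{ji}>0$, is bipartite; let $I=I_+\sqcup I_-$ be its two parts (for $n=1$ one of them is empty). For $x\in V$ let $[x:\alpha_i]$ denote the coefficient of $\alpha_i$ in the expansion of $x$ in the basis $\Pi$. For a sign $\varepsilon\in\{+,-\}$ define $\tau_\varepsilon:V\to V$ by $$[\tau_\varepsilon x:\alpha_i]=\begin{cases}-[x:\alpha_i]-\sum_{j\ne i}a_{ij}\max([x:\alpha_j],0) & \text{if } i\in I_\varepsilon,\\ [x:\alpha_i] & \text{otherwise.}\end{cases}$$ The maps $\tau_\pm$ are involutive (that is, $\tau_\pm^2=\mathrm{id}$)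 and preserve $\Phi_{\ge -1}$. Let $D$ be the group of permutations of $\Phi_{\ge -1}$ generated by $\tau_-$ and $\tau_+$. 1. Every $D$-orbit in $\Phi_{\ge -1}$ has a nonempty intersection with $-\Pi$. Moreover, $\Omega\mapsto\Omega\cap(-\Pi)$ is a bijection between the $D$-orbits in $\Phi_{\ge -1}$ and the $\langle -w_\circ\rangle$-orbits in $-\Pi$. 2. The order of $\tau_-\tau_+$ in $D$ equals $(h+2)/2$ if $w_\circ=-1$, and equals $h+2$ otherwise. Accordingly, if $n\ge 2$, then $D$ is the dihedral group of order $h+2$ if $w_\circ=-1$, and the dihedral group of order $2(h+2)$ otherwise. -/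

import Mathlib

noncomputable section

namespace FZ

open Finset Module

variable {ι M N : Type*} [AddCommGroup M] [Module ℝ M] [AddCommGroup N] [Module ℝ N]
  {P : RootPairing ι ℝ M N}

/-- The entry `a i j = ⟨αᵢ^∨, αⱼ⟩` of the Cartan matrix. (With Mathlib's convention
`P.pairing j i = ⟨root j, coroot i⟩`, so this is the transpose of `RootPairing.Base.cartanMatrix`.) -/
def cartan (b : P.Base) (i j : b.support) : ℝ := P.pairing j i

/-- The Coxeter graph: vertices are the indices of the simple roots, and `i ≠ j` are joined by an
edge whenever `a i j * a j i > 0`. -/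
def coxeterGraph (b : P.Base) : SimpleGraph b.support where
  Adj i j := i ≠ j ∧ 0 < cartan b i j * cartan b j i
  symm := ⟨fun i j h => ⟨h.1.symm, by rw [mul_comm]; exact h.2⟩⟩
  loopless := ⟨fun _ h => h.1 rfl⟩

/-- The coefficient `[x : αᵢ]` of `αᵢ` in the expansion of `x` in the basis of simple roots. -/
def coeff [P.IsRootSystem] (b : P.Base) (x : M) (i : b.support) : ℝ := b.toWeightBasis.repr x i

/-- The set `-Π` of negative simple roots. -/
def negSimple (b : P.Base) : Set M := {x | ∃ i ∈ b.support, x = -P.root i}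

/-- The set `Φ_{≥ -1}`: the positive roots together with the negative simple roots. -/
def almostPos (b : P.Base) : Set M := {x | ∃ k, b.IsPos k ∧ x = P.root k} ∪ negSimple b

open Classical in
/-- The piecewise-linear map `τ_s` of the ambient space, for a sign `s = ±1`; here `ε` is the
sign function of the bipartition `I = I₊ ∪ I₋`. -/
def tau [P.IsRootSystem] (b : P.Base) (ε : b.support → ℤˣ) (s : ℤˣ) (x : M) : M :=
  b.toWeightBasis.equivFun.symm fun i =>
    if ε i = s then -coeff b x i - ∑ j ∈ univ.erase i, cartan b i j * max (coeff b x j) 0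
    else coeff b x i

section Aux

/-! Auxiliary facts: `τ_s` is an involution and preserves `Φ_{≥ -1}`. -/

open Classical in
/-- The variant of `τ_s` where the coefficients with index in `S` are modified. -/
def tauOn [P.IsRootSystem] (b : P.Base) (S : Finset b.support) (x : M) : M :=
  b.toWeightBasis.equivFun.symm fun i =>
    if i ∈ S then -coeff b x i - ∑ j ∈ univ.erase i, cartan b i j * max (coeff b x j) 0
    else coeff b x i

open Classical in
lemma tau_eq [P.IsRootSystem] (b : P.Base) (ε : b.support → ℤˣ) (s : ℤˣ) (x : M) :
    tau b ε s x = tauOn b (univ.filter fun i => ε i = s) x := by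
  simp [tau, tauOn]

lemma coeff_ext [P.IsRootSystem] (b : P.Base) {x y : M} (h : ∀ i, coeff b x i = coeff b y i) :
    x = y :=
  b.toWeightBasis.ext_elem h

open Classical in
lemma coeff_tauOn [P.IsRootSystem] (b : P.Base) (S : Finset b.support) (x : M) (i : b.support) :
    coeff b (tauOn b S x) i =
      if i ∈ S then -coeff b x i - ∑ j ∈ univ.erase i, cartan b i j * max (coeff b x j) 0
      else coeff b x i := by
  have := congrFun (b.toWeightBasis.equivFun.apply_symm_apply fun i =>
    if i ∈ S then -coeff b x i - ∑ j ∈ univ.erase i, cartan b i j * max (coeff b x j) 0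
    else coeff b x i) i
  rw [Basis.equivFun_apply] at this
  exact this

/-- Distinct indices with the same colour have vanishing Cartan matrix entry. -/
lemma cartan_eq_zero [P.IsCrystallographic] [Finite ι] (b : P.Base)
    (ε : (coxeterGraph b).Coloring ℤˣ) {i j : b.support} (hij : i ≠ j) (h : ε i = ε j) :
    cartan b i j = 0 := by
  have hna : ¬ (coxeterGraph b).Adj i j := fun hadj => ε.valid hadj h
  by_contra hne
  have hne' : cartan b j i ≠ 0 := fun h0 => hne (P.pairing_eq_zero_iff.mp h0)
  have hle : ∀ {k l : b.support}, k ≠ l → cartan b k l ≤ 0 := by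
    intro k l hkl
    have h1 := b.pairingIn_le_zero_of_ne
      (fun h => hkl (Subtype.ext h.symm)) l.2 k.2
    have h2 : cartan b k l = ((P.pairingIn ℤ l k : ℤ) : ℝ) := by
      simp [cartan, ← P.algebraMap_pairingIn ℤ]
    rw [h2]; exact_mod_cast h1
  exact hna ⟨hij, mul_pos_of_neg_of_neg (lt_of_le_of_ne (hle hij) hne)
    (lt_of_le_of_ne (hle hij.symm) hne')⟩

lemma tau_tau [P.IsRootSystem] [P.IsCrystallographic] [Finite ι] (b : P.Base)
    (ε : (coxeterGraph b).Coloring ℤˣ) (s : ℤˣ) (x : M) : tau b ε s (tau b ε s x) = x := by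
  classical
  refine coeff_ext b fun i => ?_
  simp only [tau_eq, coeff_tauOn, mem_filter, mem_univ, true_and]
  by_cases hi : ε i = s
  · rw [if_pos hi, if_pos hi]
    have : ∑ j ∈ univ.erase i, cartan b i j * max (if ε j = s then
          -coeff b x j - ∑ k ∈ univ.erase j, cartan b j k * max (coeff b x k) 0
          else coeff b x j) 0 =
        ∑ j ∈ univ.erase i, cartan b i j * max (coeff b x j) 0 := by
      refine sum_congr rfl fun j hj => ?_
      split_ifs with hjs
      · rw [cartan_eq_zero b ε (Finset.ne_of_mem_erase hj).symm (hi.trans hjs.symm)]; simp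
      · rfl
    rw [this]; ring
  · rw [if_neg hi, if_neg hi]

lemma coeff_root_nonneg [P.IsRootSystem] (b : P.Base) {k : ι} (hk : b.IsPos k) (i : b.support) :
    0 ≤ coeff b (P.root k) i := by
  classical
  obtain ⟨f, hf, hf' | hf'⟩ := b.exists_root_eq_sum_nat_or_neg k
  · rw [hf', coeff, ← b.support.sum_coe_sort, map_sum, Finsupp.finsetSum_apply]
    refine sum_nonneg fun j _ => ?_
    rw [map_nsmul, b.toWeightBasis_repr_root]
    simp only [Finsupp.smul_apply, nsmul_eq_mul, Finsupp.single_apply]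
    split_ifs <;> simp
  · exfalso
    have h1 : P.root k = ∑ j ∈ b.support, (-(f j : ℤ)) • P.root j := by
      rw [hf']; simp
    have h2 := b.height_eq_sum h1
    rw [RootPairing.Base.isPos_iff, h2] at hk
    have : 0 ≤ ∑ j ∈ b.support, (f j : ℤ) := sum_nonneg fun _ _ => by positivity
    rw [sum_neg_distrib] at hk
    omega

open Classical in
lemma coeff_negSimple [P.IsRootSystem] (b : P.Base) (i j : b.support) :
    coeff b (-P.root j) i = if j = i then -1 else 0 := by
  rw [coeff, map_neg, b.toWeightBasis_repr_root, Finsupp.neg_apply, Finsupp.single_apply]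
  split_ifs <;> simp

lemma coeff_reflection [P.IsRootSystem] (b : P.Base) (i j : b.support) (x : M) :
    coeff b (P.reflection i x) j = coeff b x j -
      (∑ k, cartan b i k * coeff b x k) * coeff b (P.root i) j := by
  have hx : P.coroot' i x = ∑ k, cartan b i k * coeff b x k := by
    conv_lhs => rw [← b.toWeightBasis.sum_repr x]
    rw [map_sum]
    refine sum_congr rfl fun k _ => ?_
    simp [cartan, coeff, mul_comm]
  rw [P.reflection_apply, ← hx, coeff, map_sub, map_smul, Finsupp.sub_apply, Finsupp.smul_apply,
    smul_eq_mul]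
  rfl

lemma tauOn_singleton_mem [P.IsRootSystem] [P.IsCrystallographic] [P.IsReduced] [Finite ι]
    (b : P.Base) (i : b.support) {x : M} (hx : x ∈ almostPos b) :
    tauOn b {i} x ∈ almostPos b := by
  classical
  rcases hx with ⟨k, hk, rfl⟩ | ⟨j, hj, rfl⟩
  · have h1 : tauOn b {i} (P.root k) = P.reflection i (P.root k) := by
      refine coeff_ext b fun j => ?_
      rw [coeff_tauOn, coeff_reflection]
      have h2 : coeff b (P.root i) j = if i = j then 1 else 0 := by
        rw [coeff, b.toWeightBasis_repr_root, Finsupp.single_apply]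
      by_cases hij : j = i
      · subst hij
        rw [if_pos (mem_singleton_self _), h2, if_pos rfl,
          ← add_sum_erase univ _ (mem_univ j)]
        have h3 : ∑ l ∈ univ.erase j, cartan b j l * max (coeff b (P.root k) l) 0 =
            ∑ l ∈ univ.erase j, cartan b j l * coeff b (P.root k) l :=
          sum_congr rfl fun l _ => by rw [max_eq_left (coeff_root_nonneg b hk l)]
        have h4 : cartan b j j = 2 := by simp [cartan]
        rw [h3, h4]; ring
      · rw [if_neg (by simpa using hij), h2, if_neg (fun h => hij h.symm)]; ring
    rw [h1]
    by_cases hki : k = i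
    · subst hki
      exact Or.inr ⟨i, i.2, by simp⟩
    · exact Or.inl ⟨P.reflectionPerm i k,
        RootPairing.Base.IsPos.reflectionPerm hk i.2 hki, by simp⟩
  · lift j to b.support using hj
    have hmax : ∀ l, max (coeff b (-P.root j) l) 0 = 0 := by
      intro l
      rw [coeff_negSimple]
      split_ifs <;> simp
    by_cases hij : j = i
    · subst hij
      refine Or.inl ⟨j, b.isPos_of_mem_support j.2, coeff_ext b fun l => ?_⟩
      rw [coeff_tauOn]
      have h2 : coeff b (P.root j) l = if j = l then 1 else 0 := by
        rw [coeff, b.toWeightBasis_repr_root, Finsupp.single_apply]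
      simp only [hmax, h2, mul_zero, sum_const_zero, mem_singleton]
      by_cases h : j = l
      · subst h; simp [coeff_negSimple]
      · simp [coeff_negSimple, h]
    · refine Or.inr ⟨j, j.2, coeff_ext b fun l => ?_⟩
      rw [coeff_tauOn]
      simp only [hmax, mul_zero, sum_const_zero, mem_singleton]
      by_cases h : l = i
      · subst h
        rw [coeff_negSimple]; simp [hij]
      · simp [h]

lemma tau_mem [P.IsRootSystem] [P.IsCrystallographic] [P.IsReduced] [Finite ι]
    (b : P.Base) (ε : (coxeterGraph b).Coloring ℤˣ) (s : ℤˣ) {x : M} (hx : x ∈ almostPos b) :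
    tau b ε s x ∈ almostPos b := by
  classical
  rw [tau_eq]
  have key : ∀ S : Finset b.support, (∀ i ∈ S, ε i = s) → tauOn b S x ∈ almostPos b := by
    intro S
    induction S using Finset.induction_on with
    | empty =>
      intro _
      have : tauOn b ∅ x = x := coeff_ext b fun i => by simp [coeff_tauOn]
      rwa [this]
    | insert a S ha ih =>
      intro hS
      have h1 : tauOn b (insert a S) x = tauOn b {a} (tauOn b S x) := by
        refine coeff_ext b fun i => ?_
        rw [coeff_tauOn, coeff_tauOn]
        by_cases hia : i = a
        · subst hia
          rw [if_pos (mem_insert_self _ _), if_pos (mem_singleton_self _), coeff_tauOn, if_neg ha]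
          congr 1
          refine sum_congr rfl fun j hj => ?_
          rw [coeff_tauOn]
          split_ifs with hjS
          · rw [cartan_eq_zero b ε (Finset.ne_of_mem_erase hj).symm
              ((hS i (mem_insert_self _ _)).trans (hS j (mem_insert_of_mem hjS)).symm)]
            simp
          · rfl
        · simp [coeff_tauOn, hia]
      rw [h1]
      exact tauOn_singleton_mem b a (ih fun i hi => hS i (mem_insert_of_mem hi))
  exact key _ fun i hi => (mem_filter.mp hi).2

end Aux

/-- The involution `τ_s` as a permutation of `Φ_{≥ -1}`. -/
def tauPerm [P.IsRootSystem] [P.IsCrystallographic] [P.IsReduced] [Finite ι]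
    (b : P.Base) (ε : (coxeterGraph b).Coloring ℤˣ) (s : ℤˣ) : Equiv.Perm (almostPos b) where
  toFun x := ⟨tau b ε s x, tau_mem b ε s x.2⟩
  invFun x := ⟨tau b ε s x, tau_mem b ε s x.2⟩
  left_inv x := Subtype.ext (tau_tau b ε s x)
  right_inv x := Subtype.ext (tau_tau b ε s x)

/-- The group `D` of permutations of `Φ_{≥ -1}` generated by `τ₋` and `τ₊`. -/
def D [P.IsRootSystem] [P.IsCrystallographic] [P.IsReduced] [Finite ι]
    (b : P.Base) (ε : (coxeterGraph b).Coloring ℤˣ) : Subgroup (Equiv.Perm (almostPos b)) :=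
  Subgroup.closure {tauPerm b ε (-1), tauPerm b ε 1}

/-- The product `s_{i₁} ⋯ s_{iₖ}` of simple reflections in the Weyl group. -/
def wordProd (b : P.Base) (l : List b.support) : P.weylGroup :=
  (l.map fun i => RootPairing.weylGroup.ofIdx P i).prod

/-- A Coxeter element: the product of all simple reflections, each taken once, in some order. -/
def IsCoxeterElement (b : P.Base) (c : P.weylGroup) : Prop :=
  ∃ l : List b.support, l.Nodup ∧ (∀ i, i ∈ l) ∧ c = wordProd b l

/-- The length of `w`: the least length of a factorization of `w` into simple reflections. -/
def length (b : P.Base) (w : P.weylGroup) : ℕ :=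
  sInf {k | ∃ l : List b.support, l.length = k ∧ w = wordProd b l}

/-- `w` is the longest element of the Weyl group. -/
def IsLongest (b : P.Base) (w : P.weylGroup) : Prop :=
  ∀ v : P.weylGroup, length b v ≤ length b w

/-- `w` acts on the ambient space as `-1`. -/
def IsNegOne (w : P.weylGroup) : Prop := ∀ x : M, w • x = -x

/-- The cyclic group `⟨-w⟩` of linear automorphisms of the ambient space, generated by
`x ↦ -w x`. -/
def negGroup (w : P.weylGroup) : Subgroup (M ≃ₗ[ℝ] M) :=
  Subgroup.zpowers (LinearEquiv.neg ℝ * RootPairing.Equiv.weightHom P w)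

end FZ

end

noncomputable section

namespace FZ

set_option linter.unusedSectionVars false

open Finset Module

variable {ι M N : Type*} [AddCommGroup M] [Module ℝ M] [AddCommGroup N] [Module ℝ N]
  {P : RootPairing ι ℝ M N}

/-! ### Coordinates in the basis of simple roots, and positivity of roots. -/

section Coefficients

variable [P.IsRootSystem] (b : P.Base)

/-! On a positive root `τ_s` acts as the product `t_s` of the simple reflections of colour `s`
(`colourRefl`). It sends `-αᵢ` to `αᵢ` if `i` has colour `s`, and fixes `-αᵢ` otherwise. So
everything is governed by alternating products of `t₊` and `t₋`. Applied to a positive root, these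
must eventually leave the positive roots, since a bipartite Coxeter element fixes no nonzero vector,
and they can leave only at a negative simple root (`exists_exits`).

The crux is that the walk from `αᵢ` that begins with the opposite colour has an exit time
independent of `i`. Each `t_s` transposes the Euler form of the bipartite orientation, and comparing
its values along the walks from two adjacent vertices forces equal times (`exits_le_of_adj`);
irreducibility spreads this to all vertices (`exists_uniformExit`). Let `h` be the common time and
`-α_{f i}` the exit point. An alternating product of length `h` makes every simple root negative, so
it is `w₀`, and `-w₀` permutes the simple roots by `f`. Hence `(t₋ t₊) ^ h = w₀ ^ 2 = 1`, and
positivity before the exit rules out a smaller exponent. The Coxeter graph is a forest, so all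
Coxeter elements are conjugate and `h` is the Coxeter number (`UniformExit.orderOf_coxeterElement`).

The `D`-orbit of `-αᵢ` is therefore run through by `-αᵢ, αᵢ, …, -α_{f i}`, at times `0, …, h + 1`,
with positive roots strictly in between and each end fixed by the involution not yet used there. It
meets `-Π` in `{-αᵢ, -α_{f i}}`, which is a `⟨-w₀⟩`-orbit. An alternating product of `h + 2` factors
`τ_±` takes `-αᵢ` to `-α_{f i}`, so the order of `τ₋ τ₊` is `(h + 2) / 2` or `h + 2` according to
whether `f` is the identity. An edge of the graph shows that `τ₋` and `τ₊` do not commute, which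
makes `D` dihedral. -/

lemma coeff_neg (x : M) (i : b.support) : coeff b (-x) i = -coeff b x i := by
  simp [coeff]

lemma coeff_smul (r : ℝ) (x : M) (i : b.support) : coeff b (r • x) i = r * coeff b x i := by
  simp [coeff]

lemma coeff_zero (i : b.support) : coeff b (0 : M) i = 0 := by
  simp [coeff]

lemma coeff_sum {κ : Type*} (s : Finset κ) (f : κ → M) (i : b.support) :
    coeff b (∑ k ∈ s, f k) i = ∑ k ∈ s, coeff b (f k) i := by
  simp [coeff]

open Classical in
lemma coeff_root_simple (i j : b.support) :
    coeff b (P.root j) i = if j = i then 1 else 0 := by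
  rw [coeff, b.toWeightBasis_repr_root, Finsupp.single_apply]

lemma sum_coeff_smul_root (x : M) : ∑ i, coeff b x i • P.root i = x := by
  simpa [coeff] using b.toWeightBasis.sum_repr x

lemma root_simple_injective {i j : b.support} (h : P.root i = P.root j) : i = j :=
  Subtype.ext (P.root.injective h)

end Coefficients

/-- `x` is a positive root. -/
def IsPosRoot (b : P.Base) (x : M) : Prop := ∃ k, b.IsPos k ∧ x = P.root k

section PosRoot

variable [P.IsRootSystem] (b : P.Base)

lemma isPosRoot_simple [Finite ι] [P.IsCrystallographic] (i : b.support) :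
    IsPosRoot b (P.root i) :=
  ⟨i, b.isPos_of_mem_support i.2, rfl⟩

variable {b}

lemma IsPosRoot.coeff_nonneg {x : M} (h : IsPosRoot b x) (i : b.support) : 0 ≤ coeff b x i := by
  obtain ⟨k, hk, rfl⟩ := h
  exact coeff_root_nonneg b hk i

lemma IsPosRoot.ne_zero {x : M} (h : IsPosRoot b x) : x ≠ 0 := by
  obtain ⟨k, -, rfl⟩ := h
  exact P.ne_zero k

lemma IsPosRoot.exists_coeff_pos {x : M} (h : IsPosRoot b x) : ∃ i, 0 < coeff b x i := by
  by_contra! hle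
  exact h.ne_zero (coeff_ext b fun i => by
    rw [coeff_zero]; exact le_antisymm (hle i) (h.coeff_nonneg i))

lemma not_isPosRoot_of_coeff_neg {x : M} {i : b.support} (h : coeff b x i < 0) :
    ¬ IsPosRoot b x := fun hx => (hx.coeff_nonneg i).not_gt h

lemma IsPosRoot.not_neg {x : M} (h : IsPosRoot b x) : ¬ IsPosRoot b (-x) := by
  obtain ⟨i, hi⟩ := h.exists_coeff_pos
  exact not_isPosRoot_of_coeff_neg (i := i) (by rw [coeff_neg]; linarith)

variable (b) in
lemma isPosRoot_or_neg (k : ι) : IsPosRoot b (P.root k) ∨ IsPosRoot b (-P.root k) := by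
  rcases RootPairing.Base.IsPos.or_neg b k with h | h
  · exact Or.inl ⟨k, h, rfl⟩
  · exact Or.inr ⟨_, h, by simp⟩

end PosRoot

/-! ### The action of the Weyl group on roots, and words in simple reflections. -/

section Weyl

lemma weyl_smul_neg (w : P.weylGroup) (x : M) : w • (-x) = -(w • x) := smul_neg w x

lemma weyl_smul_eq_weightHom (w : P.weylGroup) (x : M) :
    w • x = RootPairing.Equiv.weightHom P w x := rfl

lemma weyl_smul_smul (w : P.weylGroup) (r : ℝ) (x : M) : w • (r • x) = r • (w • x) := by
  simp [weyl_smul_eq_weightHom]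

lemma weyl_smul_sum (w : P.weylGroup) {κ : Type*} (s : Finset κ) (f : κ → M) :
    w • (∑ k ∈ s, f k) = ∑ k ∈ s, w • f k := Finset.smul_sum

lemma weyl_eq_of_smul_eq {w v : P.weylGroup} (h : ∀ x : M, w • x = v • x) : w = v :=
  Subtype.ext (RootPairing.Equiv.weightHom_injective P (LinearEquiv.ext h))

/-- The simple (or arbitrary) reflection with index `i`, as an element of the Weyl group. -/
abbrev refl (P : RootPairing ι ℝ M N) (i : ι) : P.weylGroup := RootPairing.weylGroup.ofIdx P i

lemma refl_smul (i : ι) (x : M) : refl P i • x = P.reflection i x := rfl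

lemma refl_mul_self (i : ι) : refl P i * refl P i = 1 :=
  weyl_eq_of_smul_eq fun x => by
    rw [mul_smul, refl_smul, refl_smul, one_smul, P.reflection_same]

lemma refl_mul_refl_mul_refl (i k : ι) :
    refl P i * refl P k * refl P i = refl P (P.reflectionPerm i k) :=
  weyl_eq_of_smul_eq fun x => by
    simp only [mul_smul, refl_smul, RootPairing.reflection_reflectionPerm]
    rfl

lemma exists_weyl_smul_root (w : P.weylGroup) (k : ι) : ∃ l, w • P.root k = P.root l :=
  ⟨_, P.weylGroup_apply_root w k⟩

lemma isPosRoot_weyl_smul_or_neg [P.IsRootSystem] (b : P.Base) (w : P.weylGroup) (k : ι) :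
    IsPosRoot b (w • P.root k) ∨ IsPosRoot b (-(w • P.root k)) := by
  obtain ⟨l, hl⟩ := exists_weyl_smul_root w k
  rw [hl]
  exact isPosRoot_or_neg b l

lemma isPosRoot_refl_smul [Finite ι] [P.IsCrystallographic] [P.IsReduced] {b : P.Base} {x : M}
    (hx : IsPosRoot b x) (i : b.support) (hi : x ≠ P.root i) : IsPosRoot b (refl P i • x) := by
  obtain ⟨k, hk, rfl⟩ := hx
  exact ⟨P.reflectionPerm i k, hk.reflectionPerm i.2 (fun h => hi (by rw [h])), by
    simp⟩

@[simp] lemma wordProd_nil (b : P.Base) : wordProd b [] = 1 := rfl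

lemma wordProd_cons (b : P.Base) (i : b.support) (l : List b.support) :
    wordProd b (i :: l) = refl P i * wordProd b l := by
  simp [wordProd]

lemma wordProd_append (b : P.Base) (l m : List b.support) :
    wordProd b (l ++ m) = wordProd b l * wordProd b m := by
  simp [wordProd]

/-- Conjugating a reflection moves its root along the action; in the exchange condition this is what
cancels a letter. -/
lemma wordProd_mul_refl (b : P.Base) (l : List b.support) {k j : ι}
    (h : wordProd b l • P.root k = P.root j) :
    wordProd b l * refl P k = refl P j * wordProd b l := by
  induction l generalizing j with
  | nil =>
    rw [wordProd_nil, one_smul] at h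
    rw [P.root.injective h]; simp
  | cons a m ih =>
    obtain ⟨n, hn⟩ := exists_weyl_smul_root (wordProd b m) k
    rw [wordProd_cons, mul_smul, hn, refl_smul, ← P.root_reflectionPerm] at h
    rw [wordProd_cons, mul_assoc, ih hn, ← P.root.injective h, ← refl_mul_refl_mul_refl]
    simp only [mul_assoc]
    rw [← mul_assoc (refl P a) (refl P a) (wordProd b m), refl_mul_self, one_mul]

lemma exists_wordProd_eq [P.IsRootSystem] [Finite ι] [P.IsCrystallographic] [P.IsReduced]
    (b : P.Base) (w : P.weylGroup) : ∃ l, w = wordProd b l := by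
  have key (k : ι) : ∃ l, refl P k = wordProd b l := by
    refine b.induction_reflect k (p := fun k => ∃ l, refl P k = wordProd b l) ?_ ?_ ?_
    · rintro i ⟨l, hl⟩
      refine ⟨l, ?_⟩
      rw [← refl_mul_refl_mul_refl, refl_mul_self, one_mul, hl]
    · intro i hi
      exact ⟨[⟨i, hi⟩], by simp [wordProd_cons]⟩
    · rintro i j ⟨l, hl⟩ hj
      refine ⟨⟨j, hj⟩ :: (l ++ [⟨j, hj⟩]), ?_⟩
      rw [← refl_mul_refl_mul_refl, hl, wordProd_cons, wordProd_append, wordProd_cons,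
        wordProd_nil, mul_one, mul_assoc]
  obtain ⟨w, hw⟩ := w
  induction hw using RootPairing.weylGroup.induction with
  | mem i => exact key i
  | one => exact ⟨[], rfl⟩
  | mul x y hx hy ihx ihy =>
    obtain ⟨l, hl⟩ := ihx
    obtain ⟨m, hm⟩ := ihy
    exact ⟨l ++ m, by rw [wordProd_append, ← hl, ← hm]; rfl⟩

end Weyl

/-! ### Length, the exchange condition and the longest element. -/

section Length

variable [P.IsRootSystem] [Finite ι] [P.IsCrystallographic] [P.IsReduced] (b : P.Base)

/-- The exchange condition. -/
lemma exchange (l : List b.support) (i : b.support)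
    (h : ¬ IsPosRoot b (wordProd b l • P.root i)) :
    ∃ m : List b.support, m.length + 1 = l.length ∧ wordProd b l * refl P i = wordProd b m := by
  induction l with
  | nil => exact absurd (by simpa using isPosRoot_simple b i) h
  | cons a l ih =>
    by_cases hl : IsPosRoot b (wordProd b l • P.root i)
    -- The only positive root that the simple reflection in `a` makes negative is the simple root of
    -- `a` itself.
    · have ha : wordProd b l • P.root i = P.root a := by
        by_contra hne
        rw [wordProd_cons, mul_smul] at h
        exact h (isPosRoot_refl_smul hl a hne)
      refine ⟨l, rfl, ?_⟩
      rw [wordProd_cons, mul_assoc, wordProd_mul_refl b l ha, ← mul_assoc, refl_mul_self, one_mul]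
    · obtain ⟨m, hm, hm'⟩ := ih hl
      exact ⟨a :: m, by simp [hm], by rw [wordProd_cons, wordProd_cons, mul_assoc, hm']⟩

lemma exists_length_eq (w : P.weylGroup) :
    ∃ l : List b.support, l.length = length b w ∧ w = wordProd b l := by
  obtain ⟨l, hl⟩ := exists_wordProd_eq b w
  exact Nat.sInf_mem (s := {k | ∃ l : List b.support, l.length = k ∧ w = wordProd b l})
    ⟨_, l, rfl, hl⟩

lemma length_wordProd_le (l : List b.support) : length b (wordProd b l) ≤ l.length :=
  Nat.sInf_le ⟨l, rfl, rfl⟩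

lemma length_mul_refl_lt {w : P.weylGroup} {i : b.support} (h : ¬ IsPosRoot b (w • P.root i)) :
    length b (w * refl P i) < length b w := by
  obtain ⟨l, hl, rfl⟩ := exists_length_eq b w
  obtain ⟨m, hm, hm'⟩ := exchange b l i h
  rw [hm']
  have := length_wordProd_le b m
  omega

lemma length_lt_mul_refl {w : P.weylGroup} {i : b.support} (h : IsPosRoot b (w • P.root i)) :
    length b w < length b (w * refl P i) := by
  have h' : ¬ IsPosRoot b ((w * refl P i) • P.root i) := by
    rw [mul_smul, refl_smul, P.reflection_apply_self, weyl_smul_neg]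
    exact h.not_neg
  simpa [mul_assoc, refl_mul_self] using length_mul_refl_lt b h'

variable {b}

lemma IsLongest.not_isPosRoot {w : P.weylGroup} (hw : IsLongest b w) (i : b.support) :
    ¬ IsPosRoot b (w • P.root i) := fun h => (hw _).not_gt (length_lt_mul_refl b h)

/-- Otherwise a shortest word has a last letter; multiplying by it shortens the word, while
positivity says that it increases the length. -/
lemma eq_one_of_isPosRoot {w : P.weylGroup} (h : ∀ i : b.support, IsPosRoot b (w • P.root i)) :
    w = 1 := by
  obtain ⟨l, hl, rfl⟩ := exists_length_eq b w
  rcases l.eq_nil_or_concat' with rfl | ⟨m, i, rfl⟩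
  · rfl
  · exfalso
    have h1 := length_lt_mul_refl b (h i)
    have h2 : wordProd b (m ++ [i]) * refl P i = wordProd b m := by
      rw [wordProd_append, wordProd_cons, wordProd_nil, mul_one, mul_assoc, refl_mul_self, mul_one]
    rw [h2, ← hl] at h1
    have h3 := length_wordProd_le b m
    simp at h1
    omega

lemma isPosRoot_neg_smul {w : P.weylGroup} (h : ∀ i : b.support, ¬ IsPosRoot b (w • P.root i))
    {x : M} (hx : IsPosRoot b x) : IsPosRoot b (-(w • x)) := by
  have hle (j : b.support) : coeff b (w • x) j ≤ 0 := by
    conv_lhs => rw [← sum_coeff_smul_root b x, weyl_smul_sum, coeff_sum]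
    refine sum_nonpos fun i _ => ?_
    rw [weyl_smul_smul, coeff_smul]
    refine mul_nonpos_of_nonneg_of_nonpos (hx.coeff_nonneg i) ?_
    have := ((isPosRoot_weyl_smul_or_neg b w i).resolve_left (h i)).coeff_nonneg j
    rw [coeff_neg] at this
    linarith
  obtain ⟨k, hk, rfl⟩ := hx
  refine (isPosRoot_weyl_smul_or_neg b w k).resolve_left fun hp => ?_
  obtain ⟨j, hj⟩ := hp.exists_coeff_pos
  exact (hle j).not_gt hj

/-- There is only one element of the Weyl group sending all simple roots to negative roots. -/
lemma eq_of_not_isPosRoot {w v : P.weylGroup}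
    (hw : ∀ i : b.support, ¬ IsPosRoot b (w • P.root i))
    (hv : ∀ i : b.support, ¬ IsPosRoot b (v • P.root i)) : w = v := by
  suffices v⁻¹ * w = 1 from (inv_mul_eq_one.mp this).symm
  refine eq_one_of_isPosRoot (b := b) fun i => ?_
  by_contra hn
  have h1 := (isPosRoot_weyl_smul_or_neg b (v⁻¹ * w) i).resolve_left hn
  have h2 := isPosRoot_neg_smul hv h1
  rw [weyl_smul_neg, neg_neg, smul_smul, mul_inv_cancel_left] at h2
  exact hw i h2

end Length

/-! ### Orderings of the vertices of a forest, up to rotation and commutation. -/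

section Orderings

variable {I : Type*}

/-- Two words are related if they differ by a rotation or by swapping adjacent letters that are
not joined in the graph `G`. -/
inductive RotSwap (G : SimpleGraph I) : List I → List I → Prop
  | rotate (a : I) (l : List I) : RotSwap G (a :: l) (l ++ [a])
  | swap (l m : List I) (a c : I) (h : ¬ G.Adj a c) :
      RotSwap G (l ++ a :: c :: m) (l ++ c :: a :: m)

variable {G : SimpleGraph I}

lemma eqvGen_rotate (l m : List I) : Relation.EqvGen (RotSwap G) (l ++ m) (m ++ l) := by
  induction l generalizing m with
  | nil => simpa using Relation.EqvGen.refl _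
  | cons a l ih =>
    refine (Relation.EqvGen.rel _ _ (RotSwap.rotate a (l ++ m))).trans _ _ _ ?_
    simpa using ih (m ++ [a])

lemma eqvGen_move (a : I) (k l m : List I) (h : ∀ c ∈ l, ¬ G.Adj a c) :
    Relation.EqvGen (RotSwap G) (k ++ a :: (l ++ m)) (k ++ l ++ a :: m) := by
  induction l generalizing k with
  | nil => simpa using Relation.EqvGen.refl _
  | cons c l ih =>
    refine (Relation.EqvGen.rel _ _ (RotSwap.swap k (l ++ m) a c (h c (by simp)))).trans _ _ _ ?_
    simpa using ih (k ++ [c]) fun d hd => h d (by simp [hd])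

/-- Prefixing a letter that has at most one neighbour among the other letters
is compatible with the equivalence of words. -/
lemma eqvGen_cons {v : I} {S : Set I} (hS : ∀ a ∈ S, ∀ c ∈ S, G.Adj v a → G.Adj v c → a = c)
    {l m : List I} (h : Relation.EqvGen (RotSwap G) l m) (hl : l.Nodup) (hlS : ∀ a ∈ l, a ∈ S) :
    Relation.EqvGen (RotSwap G) (v :: l) (v :: m) := by
  have perm {l m : List I} (h : Relation.EqvGen (RotSwap G) l m) : l.Perm m := by
    induction h with
    | rel x y h =>
      cases h with
      | rotate a l => exact (List.perm_append_singleton a l).symm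
      | swap l m a c _ => exact (List.Perm.swap c a m).append_left l
    | refl x => exact .refl _
    | symm x y _ ih => exact ih.symm
    | trans x y z _ _ ih₁ ih₂ => exact ih₁.trans ih₂
  induction h with
  | rel x y h =>
    cases h with
    | rotate a l =>
      by_cases hva : G.Adj v a
      -- Here `a` is the only neighbour of `v` in `S`, so `v` commutes with `l`: rotated to the end,
      -- `v` can move back through `l` to just behind `a`, after which `a` is rotated.
      · have hvl : ∀ c ∈ l, ¬ G.Adj v c := fun c hc hvc => by
          have := hS a (hlS a (by simp)) c (hlS c (by simp [hc])) hva hvc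
          subst this
          exact (List.nodup_cons.mp hl).1 hc
        have h1 : Relation.EqvGen (RotSwap G) (v :: a :: l) (a :: (l ++ [v])) :=
          .rel _ _ (RotSwap.rotate v (a :: l))
        have h2 : Relation.EqvGen (RotSwap G) (a :: v :: l) (a :: (l ++ [v])) := by
          simpa using eqvGen_move v [a] l [] hvl
        have h3 : Relation.EqvGen (RotSwap G) (a :: v :: l) (v :: (l ++ [a])) :=
          .rel _ _ (RotSwap.rotate a (v :: l))
        exact (h1.trans _ _ _ (h2.symm _ _)).trans _ _ _ h3
      · exact (Relation.EqvGen.rel _ _ (RotSwap.swap [] l v a hva)).trans _ _ _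
          (.rel _ _ (RotSwap.rotate a (v :: l)))
    | swap l m a c h => exact .rel _ _ (RotSwap.swap (v :: l) m a c h)
  | refl x => exact .refl _
  | symm x y hxy ih =>
    have hp := perm hxy
    exact (ih (hp.nodup_iff.mpr hl) fun a ha => hlS a (hp.mem_iff.mp ha)).symm
  | trans x y z hxy hyz ih₁ ih₂ =>
    have hp := perm hxy
    exact (ih₁ hl hlS).trans _ _ _
      (ih₂ (hp.nodup_iff.mp hl) fun a ha => hlS a (hp.mem_iff.mpr ha))

/-- In a forest (a graph all of whose nonempty subsets of vertices have a vertex of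
degree at most one), all orderings of a set of vertices are equivalent. -/
lemma eqvGen_of_perm
    (hG : ∀ S : Finset I, S.Nonempty → ∃ v ∈ S, ∀ a ∈ S, ∀ c ∈ S, G.Adj v a → G.Adj v c → a = c)
    {l m : List I} (hl : l.Nodup) (hlm : l.Perm m) : Relation.EqvGen (RotSwap G) l m := by
  classical
  induction hn : l.length generalizing l m with
  | zero =>
    obtain rfl := List.length_eq_zero_iff.mp hn
    obtain rfl := hlm.nil_eq
    exact .refl _
  | succ n ih =>
    obtain ⟨v, hv, hv'⟩ := hG l.toFinset (by
      rw [List.toFinset_nonempty_iff]; rintro rfl; simp at hn)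
    obtain ⟨l₁, l₂, rfl⟩ := List.append_of_mem (List.mem_toFinset.mp hv)
    obtain ⟨m₁, m₂, rfl⟩ := List.append_of_mem (hlm.mem_iff.mp (List.mem_toFinset.mp hv))
    -- Rotating both words to begin with the leaf `v` reduces the claim to words without `v`.
    have e₁ : Relation.EqvGen (RotSwap G) (l₁ ++ v :: l₂) (v :: (l₂ ++ l₁)) := by
      simpa using eqvGen_rotate l₁ (v :: l₂)
    have e₂ : Relation.EqvGen (RotSwap G) (m₁ ++ v :: m₂) (v :: (m₂ ++ m₁)) := by
      simpa using eqvGen_rotate m₁ (v :: m₂)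
    have p₁ : (l₁ ++ v :: l₂).Perm (v :: (l₂ ++ l₁)) := by
      simpa using List.perm_append_comm (l₁ := l₁) (l₂ := v :: l₂)
    have p₂ : (m₁ ++ v :: m₂).Perm (v :: (m₂ ++ m₁)) := by
      simpa using List.perm_append_comm (l₁ := m₁) (l₂ := v :: m₂)
    have hp : (l₂ ++ l₁).Perm (m₂ ++ m₁) := ((p₁.symm.trans hlm).trans p₂).cons_inv
    have hnd : (l₂ ++ l₁).Nodup := (List.nodup_cons.mp (p₁.nodup_iff.mp hl)).2
    have hlen : (l₂ ++ l₁).length = n := by simp at hn ⊢; omega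
    have e₃ := eqvGen_cons (v := v) (S := {a | a ∈ l₁ ++ v :: l₂})
      (fun a ha c hc => hv' a (List.mem_toFinset.mpr ha) c (List.mem_toFinset.mpr hc))
      (ih hnd hp hlen) hnd (fun a ha => p₁.mem_iff.mpr (by simp at ha ⊢; tauto))
    exact (e₁.trans _ _ _ e₃).trans _ _ _ (e₂.symm _ _)

end Orderings

/-! ### The Cartan matrix: symmetrizability, and the Coxeter graph as a forest. -/

section Cartan

variable [Finite ι] [P.IsCrystallographic] (b : P.Base)

lemma cartan_self (i : b.support) : cartan b i i = 2 := by simp [cartan]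

lemma cartan_eq_int (i j : b.support) : cartan b i j = ((P.pairingIn ℤ j i : ℤ) : ℝ) := by
  simp [cartan, ← P.algebraMap_pairingIn ℤ]

lemma cartan_nonpos {i j : b.support} (h : i ≠ j) : cartan b i j ≤ 0 := by
  rw [cartan_eq_int]
  exact_mod_cast b.pairingIn_le_zero_of_ne (fun h' => h (Subtype.ext h'.symm)) j.2 i.2

lemma one_le_cartan_mul_cartan {i j : b.support} (h : (coxeterGraph b).Adj i j) :
    1 ≤ cartan b i j * cartan b j i := by
  have h2 := h.2
  rw [cartan_eq_int, cartan_eq_int] at h2 ⊢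
  norm_cast at h2 ⊢

lemma cartan_neg_of_adj {i j : b.support} (h : (coxeterGraph b).Adj i j) : cartan b i j < 0 :=
  lt_of_le_of_ne (cartan_nonpos b h.1) fun h0 => by
    have := h.2
    rw [h0, zero_mul] at this
    exact this.false

variable [P.IsRootSystem]

variable (P) in
lemma exists_posDef_form : ∃ B : LinearMap.BilinForm ℝ M, (∀ x y, B x y = B y x) ∧
    (∀ x, B x x ≤ 0 → x = 0) ∧
    ∀ i j, 2 * B (P.root i) (P.root j) = P.pairing i j * B (P.root j) (P.root j) := by
  have := Fintype.ofFinite ι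
  refine ⟨P.RootForm, fun x y => P.rootForm_symmetric.eq x y, fun x hx => ?_, fun i j =>
    P.toInvariantForm.two_mul_apply_root_root i j⟩
  exact P.rootForm_anisotropic x (le_antisymm hx (P.zero_le_rootForm x))

/-- The Cartan matrix is symmetrizable. -/
lemma exists_symmetrizer : ∃ d : b.support → ℝ, (∀ i, 0 < d i) ∧
    ∀ i j, d i * cartan b i j = d j * cartan b j i := by
  obtain ⟨B, hsymm, hpos, hB⟩ := exists_posDef_form P
  refine ⟨fun i => B (P.root i) (P.root i), fun i => ?_, fun i j => ?_⟩
  · by_contra! h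
    exact P.ne_zero i (hpos _ h)
  · have h1 := hB j i
    have h2 := hB i j
    rw [hsymm] at h1
    simp only [cartan]
    linarith

/-- The Coxeter graph is a forest. -/
lemma coxeterGraph_exists_leaf (S : Finset b.support) (hS : S.Nonempty) :
    ∃ v ∈ S, ∀ a ∈ S, ∀ c ∈ S, (coxeterGraph b).Adj v a → (coxeterGraph b).Adj v c → a = c := by
  classical
  by_contra! hcon
  obtain ⟨B, hsymm, hpos, hB⟩ := exists_posDef_form P
  have hd (i : b.support) : 0 < B (P.root i) (P.root i) := by
    by_contra! h
    exact P.ne_zero i (hpos _ h)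
  set r : b.support → ℝ := fun i => √(B (P.root i) (P.root i)) with hr
  have hrpos (i) : 0 < r i := Real.sqrt_pos.mpr (hd i)
  have hrsq (i : b.support) : B (P.root i) (P.root i) = r i ^ 2 := (Real.sq_sqrt (hd i).le).symm
  have hterm0 (i j : b.support) (hij : i ≠ j) : B (P.root i) (P.root j) ≤ 0 := by
    have h1 := hB i j
    have h2 := cartan_nonpos b hij.symm
    have h3 := hd j
    simp only [cartan] at h2
    nlinarith
  have hterm1 (i j : b.support) (hij : (coxeterGraph b).Adj i j) :
      B (P.root i) (P.root j) ≤ -(1 / 2) * (r i * r j) := by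
    have h0 := hterm0 i j hij.1
    have h1 := hB i j
    have h2 := hB j i
    have h3 := one_le_cartan_mul_cartan b hij
    simp only [cartan] at h3
    rw [hsymm] at h2
    rw [hrsq] at h1 h2
    -- Integrality enters here: on an edge the product of the two Cartan entries is at least `1`.
    have h4 : (r i * r j) ^ 2 ≤ (2 * B (P.root i) (P.root j)) ^ 2 := by
      calc (r i * r j) ^ 2 ≤ (P.pairing j i * P.pairing i j) * (r i * r j) ^ 2 :=
            le_mul_of_one_le_left (sq_nonneg _) h3
        _ = (2 * B (P.root i) (P.root j)) * (2 * B (P.root i) (P.root j)) := by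
            nth_rw 1 [h1]; rw [h2]; ring
        _ = _ := by ring
    have h5 := sq_le_sq.mp h4
    rw [abs_of_pos (mul_pos (hrpos i) (hrpos j)), abs_of_nonpos (by linarith)] at h5
    linarith
  -- The sum of the normalized simple roots. With two neighbours for each vertex of `S`, every row
  -- of the normalized Gram matrix sums to at most `1 - 1/2 - 1/2`, against positive definiteness.
  set x : M := ∑ i ∈ S, (r i)⁻¹ • P.root i with hx
  have hxx : B x x ≤ 0 := by
    have : B x x = ∑ i ∈ S, ∑ j ∈ S, (r i)⁻¹ * (r j)⁻¹ * B (P.root i) (P.root j) := by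
      simp only [hx, map_sum, LinearMap.sum_apply, map_smul, LinearMap.smul_apply, smul_eq_mul,
        mul_sum]
      rw [sum_comm]
      exact sum_congr rfl fun i _ => sum_congr rfl fun j _ => by ring
    rw [this]
    refine sum_nonpos fun i hi => ?_
    obtain ⟨a, ha, c, hc, hia, hic, hac⟩ := hcon i hi
    have hsub : ({i, a, c} : Finset b.support) ⊆ S := by
      intro k hk
      simp only [mem_insert, mem_singleton] at hk
      rcases hk with rfl | rfl | rfl <;> assumption
    rw [← sum_sdiff hsub]
    have h1 : ∑ j ∈ S \ {i, a, c}, (r i)⁻¹ * (r j)⁻¹ * B (P.root i) (P.root j) ≤ 0 := by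
      refine sum_nonpos fun j hj => mul_nonpos_of_nonneg_of_nonpos
        (by have := hrpos i; have := hrpos j; positivity) (hterm0 i j ?_)
      rintro rfl
      simp at hj
    have h2 {j} (hij : (coxeterGraph b).Adj i j) :
        (r i)⁻¹ * (r j)⁻¹ * B (P.root i) (P.root j) ≤ -(1 / 2) := by
      have h3 := hrpos i
      have h4 := hrpos j
      calc (r i)⁻¹ * (r j)⁻¹ * B (P.root i) (P.root j)
          ≤ (r i)⁻¹ * (r j)⁻¹ * (-(1 / 2) * (r i * r j)) := by
            gcongr; exact hterm1 i j hij
        _ = -(1 / 2) := by field_simp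
    have h3 : (r i)⁻¹ * (r i)⁻¹ * B (P.root i) (P.root i) = 1 := by
      rw [hrsq]; have := hrpos i; field_simp
    rw [sum_insert (by simp [hia.1, hic.1]), sum_insert (by simp [hac]), sum_singleton, h3]
    linarith [h2 hia, h2 hic]
  have hx0 := hpos x hxx
  obtain ⟨i, hi⟩ := hS
  have h1 : coeff b x i = (r i)⁻¹ := by
    rw [hx, coeff_sum]
    simp [coeff_smul, coeff_root_simple, hi]
  rw [hx0, coeff_zero] at h1
  exact (inv_pos.mpr (hrpos i)).ne h1

end Cartan

/-! ### Conjugacy of Coxeter elements. -/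

section Coxeter

variable [Finite ι] [P.IsCrystallographic] [P.IsRootSystem] {b : P.Base}

lemma refl_commute {i j : b.support} (h : ¬ (coxeterGraph b).Adj i j) :
    refl P i * refl P j = refl P j * refl P i := by
  by_cases hij : i = j
  · rw [hij]
  have h0 : P.pairing j i = 0 := by
    by_contra h0
    refine h ⟨hij, mul_pos_of_neg_of_neg (lt_of_le_of_ne (cartan_nonpos b hij) h0)
      (lt_of_le_of_ne (cartan_nonpos b (Ne.symm hij)) fun h1 => h0 (P.pairing_eq_zero_iff.mp h1))⟩
  have h0' : P.pairing i j = 0 := P.pairing_eq_zero_iff.mp h0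
  refine weyl_eq_of_smul_eq fun x => ?_
  simp only [mul_smul, refl_smul, P.reflection_apply, map_sub, map_smul, smul_eq_mul,
    RootPairing.root_coroot'_eq_pairing, h0, h0']
  simp
  abel

/-- Any two Coxeter elements are conjugate. -/
lemma IsCoxeterElement.isConj {c c' : P.weylGroup} (hc : IsCoxeterElement b c)
    (hc' : IsCoxeterElement b c') : IsConj c c' := by
  obtain ⟨l, hl, hl', rfl⟩ := hc
  obtain ⟨m, hm, hm', rfl⟩ := hc'
  have hlm : l.Perm m := (List.perm_ext_iff_of_nodup hl hm).mpr fun a => by simp [hl', hm']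
  have h := eqvGen_of_perm (coxeterGraph_exists_leaf b) hl hlm
  clear hlm hl hm hl' hm'
  induction h with
  | rel x y h =>
    cases h with
    | rotate a l =>
      rw [isConj_iff]
      refine ⟨(refl P a)⁻¹, ?_⟩
      rw [wordProd_append, wordProd_cons, wordProd_cons, wordProd_nil]
      group
    | swap l m a d h =>
      rw [wordProd_append, wordProd_append, wordProd_cons, wordProd_cons, wordProd_cons,
        wordProd_cons, ← mul_assoc (refl P a), refl_commute h, mul_assoc (refl P d)]
  | refl x => exact IsConj.refl _
  | symm x y _ ih => exact ih.symm
  | trans x y z _ _ ih₁ ih₂ => exact ih₁.trans ih₂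

lemma orderOf_eq_of_isConj {G : Type*} [Group G] {a c : G} (h : IsConj a c) :
    orderOf a = orderOf c := by
  obtain ⟨g, rfl⟩ := isConj_iff.mp h
  rw [← MulAut.conj_apply, MulEquiv.orderOf_eq]

end Coxeter

lemma units_eq_neg_of_ne {s r : ℤˣ} (h : s ≠ r) : s = -r := by
  rcases Int.units_eq_one_or s with rfl | rfl <;> rcases Int.units_eq_one_or r with rfl | rfl <;>
    simp_all

lemma units_ne_neg (s : ℤˣ) : s ≠ -s := by
  rcases Int.units_eq_one_or s with rfl | rfl <;> decide

/-! ### Alternating products of two elements indexed by signs. -/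

section AlternatingProduct

variable {G : Type*} [Monoid G] (t : ℤˣ → G)

/-- The alternating product `⋯ t (-s) * t s` with `k` factors. -/
def altProd (s : ℤˣ) : ℕ → G
  | 0 => 1
  | k + 1 => t (s * (-1) ^ k) * altProd s k

@[simp] lemma altProd_zero (s : ℤˣ) : altProd t s 0 = 1 := rfl

lemma altProd_succ (s : ℤˣ) (k : ℕ) :
    altProd t s (k + 1) = t (s * (-1) ^ k) * altProd t s k := rfl

lemma altProd_add (s : ℤˣ) (k m : ℕ) :
    altProd t s (k + m) = altProd t (s * (-1) ^ m) k * altProd t s m := by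
  induction k with
  | zero => simp
  | succ k ih =>
    rw [Nat.succ_add, altProd_succ, ih, altProd_succ, mul_assoc, pow_add]
    congr 2
    rw [mul_assoc, mul_comm ((-1) ^ k)]

lemma altProd_succ' (s : ℤˣ) (k : ℕ) :
    altProd t s (k + 1) = altProd t (-s) k * t s := by
  rw [altProd_add, altProd_succ]
  simp

lemma altProd_two_mul (s : ℤˣ) (k : ℕ) : altProd t s (2 * k) = (t (-s) * t s) ^ k := by
  induction k with
  | zero => simp
  | succ k ih =>
    rw [Nat.mul_succ, add_comm, altProd_add, Even.neg_one_pow (even_two_mul k), mul_one, ih,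
      pow_succ', altProd_succ, altProd_succ]
    simp

end AlternatingProduct

/-! ### Products of the simple reflections of one colour. -/

section ColourReflection

variable [Finite ι] [P.IsCrystallographic] [P.IsRootSystem] (b : P.Base)
  (ε : (coxeterGraph b).Coloring ℤˣ)

lemma coeff_refl_smul (i j : b.support) (x : M) :
    coeff b (refl P i • x) j = coeff b x j -
      (∑ k, cartan b i k * coeff b x k) * coeff b (P.root i) j :=
  coeff_reflection b i j x

open Classical in
lemma coeff_wordProd_smul_of_colour {s : ℤˣ} {l : List b.support} (hl : l.Nodup)
    (hs : ∀ i ∈ l, ε i = s) (x : M) (i : b.support) :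
    coeff b (wordProd b l • x) i =
      if i ∈ l then coeff b x i - ∑ k, cartan b i k * coeff b x k else coeff b x i := by
  induction l generalizing i with
  | nil => simp
  | cons a l ih =>
    have ih' := ih (List.nodup_cons.mp hl).2 (fun j hj => hs j (by simp [hj]))
    have ha := (List.nodup_cons.mp hl).1
    have hsum : ∑ k, cartan b a k * coeff b (wordProd b l • x) k =
        ∑ k, cartan b a k * coeff b x k := by
      refine sum_congr rfl fun k _ => ?_
      rw [ih' k]
      split_ifs with hk
      · rw [cartan_eq_zero b ε (i := a) (j := k) (by rintro rfl; exact ha hk)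
          ((hs a (by simp)).trans (hs k (by simp [hk])).symm)]
        simp
      · rfl
    rw [wordProd_cons, mul_smul, coeff_refl_smul, hsum, ih' i, coeff_root_simple]
    by_cases hia : a = i
    · subst hia
      simp [ha]
    · simp [hia, Ne.symm hia]

open Classical in
/-- The product of all simple reflections of colour `s`. -/
def colourRefl (s : ℤˣ) : P.weylGroup :=
  wordProd b (univ.filter fun i => ε i = s).toList

lemma coeff_colourRefl_smul (s : ℤˣ) (x : M) (i : b.support) :
    coeff b (colourRefl b ε s • x) i =
      if ε i = s then coeff b x i - ∑ k, cartan b i k * coeff b x k else coeff b x i := by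
  rw [colourRefl, coeff_wordProd_smul_of_colour b ε (s := s) (Finset.nodup_toList _)
    (fun i hi => by simpa using hi)]
  simp

/-- Subtracting `2 * f i` removes the diagonal term, and the other Cartan entries within the colour
`s` vanish. -/
lemma sum_cartan_mul_of_colour {s : ℤˣ} {i : b.support} (hi : ε i = s) {f g : b.support → ℝ}
    (h : ∀ k, ε k ≠ s → f k = g k) :
    ∑ k, cartan b i k * f k - 2 * f i = ∑ k, cartan b i k * g k - 2 * g i := by
  classical
  rw [← add_sum_erase _ _ (mem_univ i), ← add_sum_erase _ _ (mem_univ i), cartan_self,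
    add_sub_cancel_left, add_sub_cancel_left]
  refine sum_congr rfl fun k hk => ?_
  by_cases hks : ε k = s
  · rw [cartan_eq_zero b ε (Finset.ne_of_mem_erase hk).symm (hi.trans hks.symm)]
    simp
  · rw [h k hks]

lemma colourRefl_mul_self (s : ℤˣ) : colourRefl b ε s * colourRefl b ε s = 1 := by
  refine weyl_eq_of_smul_eq fun x => coeff_ext b fun i => ?_
  rw [mul_smul, one_smul, coeff_colourRefl_smul]
  split_ifs with hi
  · have h := sum_cartan_mul_of_colour b ε hi
      (f := fun k => coeff b (colourRefl b ε s • x) k) (g := coeff b x)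
      fun k hk => by rw [coeff_colourRefl_smul, if_neg hk]
    have h2 := coeff_colourRefl_smul b ε s x i
    rw [if_pos hi] at h2
    linarith
  · rw [coeff_colourRefl_smul, if_neg hi]

lemma colourRefl_smul_root {s : ℤˣ} {i : b.support} (hi : ε i = s) :
    colourRefl b ε s • P.root i = -P.root i := by
  classical
  refine coeff_ext b fun j => ?_
  rw [coeff_colourRefl_smul, coeff_neg, coeff_root_simple]
  simp only [coeff_root_simple, mul_ite, mul_one, mul_zero, sum_ite_eq, mem_univ, if_true]
  by_cases hij : i = j
  · subst hij
    simp [hi, cartan_self]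
    norm_num
  · simp only [hij, if_false]
    split_ifs with hj
    · rw [cartan_eq_zero b ε (Ne.symm hij) (hj.trans hi.symm)]
      simp
    · simp

/-- Read letter by letter, the root turns negative only on becoming the simple root of the current
letter. The letters already applied have the same colour and fix that simple root, so the root was
simple from the start. -/
lemma exists_eq_simple_of_not_isPosRoot [P.IsReduced] {s : ℤˣ} {x : M} (hx : IsPosRoot b x)
    (h : ¬ IsPosRoot b (colourRefl b ε s • x)) : ∃ i : b.support, ε i = s ∧ x = P.root i := by
  classical
  suffices key : ∀ l : List b.support, l.Nodup → (∀ i ∈ l, ε i = s) →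
      ¬ IsPosRoot b (wordProd b l • x) → ∃ i ∈ l, x = P.root i by
    obtain ⟨i, hi, hx⟩ := key _ (Finset.nodup_toList _) (fun i hi => by simpa using hi) h
    exact ⟨i, by simpa using hi, hx⟩
  intro l hl hs hn
  induction l with
  | nil => exact absurd (by simpa using hx) hn
  | cons a l ih =>
    have ha := (List.nodup_cons.mp hl).1
    have hl' := (List.nodup_cons.mp hl).2
    have hs' : ∀ i ∈ l, ε i = s := fun i hi => hs i (by simp [hi])
    by_cases hp : IsPosRoot b (wordProd b l • x)
    · have h1 : wordProd b l • x = P.root a := by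
        by_contra hne
        rw [wordProd_cons, mul_smul] at hn
        exact hn (isPosRoot_refl_smul hp a hne)
      have h2 : wordProd b l • P.root a = P.root a := by
        refine coeff_ext b fun i => ?_
        rw [coeff_wordProd_smul_of_colour b ε hl' hs']
        split_ifs with hi
        · simp only [coeff_root_simple, mul_ite, mul_one, mul_zero, sum_ite_eq, mem_univ, if_true]
          rw [cartan_eq_zero b ε (i := i) (j := a) (by rintro rfl; exact ha hi)
            ((hs' i hi).trans (hs a (by simp)).symm)]
          simp
        · rfl
      exact ⟨a, by simp, smul_left_cancel _ (h1.trans h2.symm)⟩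
    · obtain ⟨i, hi, hx⟩ := ih hl' hs' hp
      exact ⟨i, by simp [hi], hx⟩

end ColourReflection

/-! ### The Euler form and its behaviour under colour reflections. -/

section EulerForm

variable [Finite ι] [P.IsCrystallographic] [P.IsRootSystem] (b : P.Base)
  (ε : (coxeterGraph b).Coloring ℤˣ)

/-- The Euler form of the bipartite orientation in which the vertices of colour `s` come first,
attached to a symmetrizer `d` of the Cartan matrix. -/
def eulerForm (d : b.support → ℝ) (s : ℤˣ) (x y : M) : ℝ :=
  ∑ i, (d i * coeff b x i * coeff b y i + if ε i = s then
    d i * coeff b x i * (∑ k, cartan b i k * coeff b y k - 2 * coeff b y i) else 0)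

lemma eulerForm_neg_left (d : b.support → ℝ) (s : ℤˣ) (x y : M) :
    eulerForm b ε d s (-x) y = -eulerForm b ε d s x y := by
  simp only [eulerForm, coeff_neg, ← sum_neg_distrib]
  refine sum_congr rfl fun i _ => ?_
  split_ifs <;> ring

variable {d : b.support → ℝ} (hd : ∀ i j, d i * cartan b i j = d j * cartan b j i)

include hd in
lemma eulerForm_swap (s : ℤˣ) (x y : M) :
    eulerForm b ε d s x y = eulerForm b ε d (-s) y x := by
  classical
  have hsum (r : ℤˣ) (x y : M) : eulerForm b ε d r x y = ∑ i, d i * coeff b x i * coeff b y i +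
      ∑ i, ∑ k, if ε i = r ∧ ε k = -r then d i * cartan b i k * (coeff b x i * coeff b y k)
        else 0 := by
    rw [eulerForm, sum_add_distrib]
    congr 1
    refine sum_congr rfl fun i _ => ?_
    split_ifs with hi
    · have h := sum_cartan_mul_of_colour b ε hi (f := coeff b y)
        (g := fun k => if ε k = -r then coeff b y k else 0)
        fun k hk => by rw [if_pos (units_eq_neg_of_ne hk)]
      simp only [hi, units_ne_neg, if_false] at h
      rw [h, mul_zero, sub_zero, mul_sum]
      refine sum_congr rfl fun k _ => ?_
      simp only [hi, true_and]
      split_ifs <;> ring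
    · simp [hi]
  rw [hsum, hsum, sum_comm (γ := b.support)]
  congr 1
  · exact sum_congr rfl fun i _ => by ring
  · refine sum_congr rfl fun i _ => sum_congr rfl fun k _ => ?_
    rw [neg_neg, hd k i]
    by_cases hi : ε i = -s <;> by_cases hk : ε k = s <;> simp only [hi, hk,
      and_self, and_true, and_false, if_true, if_false]
    ring

include hd in
lemma eulerForm_neg_right (s : ℤˣ) (x y : M) :
    eulerForm b ε d s x (-y) = -eulerForm b ε d s x y := by
  rw [eulerForm_swap b ε hd, eulerForm_neg_left, ← eulerForm_swap b ε hd]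

-- For the colour that comes first, writing `X`, `Y` for the contributions of the neighbours, the
-- term at `i` becomes `d i * (-x - X) * (-y - Y + Y) = d i * y * (x + X)`, which is the transposed
-- term. The other colour follows through `eulerForm_swap`.
include hd in
lemma eulerForm_colourRefl_smul (s r : ℤˣ) (x y : M) :
    eulerForm b ε d s (colourRefl b ε r • x) (colourRefl b ε r • y) = eulerForm b ε d s y x := by
  have key (s : ℤˣ) (x y : M) :
      eulerForm b ε d s (colourRefl b ε s • x) (colourRefl b ε s • y) = eulerForm b ε d s y x := by
    refine sum_congr rfl fun i _ => ?_
    by_cases hi : ε i = s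
    · rw [if_pos hi, if_pos hi, sum_cartan_mul_of_colour b ε hi
        (f := fun k => coeff b (colourRefl b ε s • y) k) (g := coeff b y)
        fun k hk => by rw [coeff_colourRefl_smul, if_neg hk]]
      simp only [coeff_colourRefl_smul, hi, if_true]
      ring
    · rw [if_neg hi, if_neg hi]
      simp only [coeff_colourRefl_smul, hi, if_false]
      ring
  by_cases h : r = s
  · rw [h, key]
  · rw [units_eq_neg_of_ne h, eulerForm_swap b ε hd, key, eulerForm_swap b ε hd, neg_neg]

include hd in
lemma eulerForm_altProd_smul (s r : ℤˣ) (k : ℕ) (x y : M) :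
    eulerForm b ε d (s * (-1) ^ k) (altProd (colourRefl b ε) r k • x)
        (altProd (colourRefl b ε) r k • y) =
      eulerForm b ε d s x y := by
  induction k with
  | zero => simp
  | succ k ih =>
    rw [altProd_succ, mul_smul, mul_smul, eulerForm_colourRefl_smul b ε hd,
      eulerForm_swap b ε hd, ← ih]
    simp [pow_succ]

lemma eulerForm_root_left {s : ℤˣ} {j : b.support} (hj : ε j = -s) (y : M) :
    eulerForm b ε d s (P.root j) y = d j * coeff b y j := by
  classical
  rw [eulerForm, sum_eq_single j]
  · simp [coeff_root_simple, hj, (units_ne_neg s).symm]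
  · intro i _ hij
    simp [coeff_root_simple, hij.symm]
  · simp

include hd in
lemma eulerForm_root_root {s : ℤˣ} {i j : b.support} (hi : ε i = s) (hj : ε j = -s) :
    eulerForm b ε d s (P.root i) (P.root j) = d i * cartan b i j := by
  classical
  have hij : i ≠ j := fun h => units_ne_neg s (hi.symm.trans (h ▸ hj))
  rw [eulerForm, sum_eq_single i]
  · simp [coeff_root_simple, hi, hij.symm]
  · intro k _ hki
    simp [coeff_root_simple, hki.symm]
  · simp

end EulerForm

/-! ### Alternating walks through the positive roots, and their exit times. -/

section Walk

variable [Finite ι] [P.IsCrystallographic] [P.IsRootSystem] (b : P.Base)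
  (ε : (coxeterGraph b).Coloring ℤˣ)

/-- The roots span, so an element is determined by its permutation of the finitely many roots. -/
instance finite_weylGroup : Finite P.weylGroup := by
  have hinj : Function.Injective P.weylGroupToPerm := fun w v h => by
    refine weyl_eq_of_smul_eq fun x => ?_
    have hx : x ∈ P.rootSpan ℝ := by simp
    induction hx using Submodule.span_induction with
    | mem x hx =>
      obtain ⟨k, rfl⟩ := hx
      rw [P.weylGroup_apply_root, P.weylGroup_apply_root, h]
    | zero => rw [smul_zero, smul_zero]
    | add x y _ _ hx hy => rw [smul_add, smul_add, hx, hy]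
    | smul r x _ hx => rw [weyl_smul_smul, weyl_smul_smul, hx]
  exact Finite.of_injective _ hinj

lemma eq_zero_of_sum_cartan_eq_zero {x : M} (h : ∀ i, ∑ k, cartan b i k * coeff b x k = 0) :
    x = 0 := by
  obtain ⟨B, hsymm, hpos, hB⟩ := exists_posDef_form P
  have h1 (i : b.support) : B (P.root i) x = 0 := by
    have h2 : 2 * B (P.root i) x =
        (∑ k, cartan b i k * coeff b x k) * B (P.root i) (P.root i) := by
      conv_lhs => rw [← sum_coeff_smul_root b x]
      rw [map_sum, mul_sum, sum_mul]
      refine sum_congr rfl fun k _ => ?_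
      rw [map_smul, smul_eq_mul, hsymm]
      have := hB k i
      simp only [cartan]
      linear_combination coeff b x k * this
    rw [h i] at h2
    linarith
  refine hpos x (le_of_eq ?_)
  nth_rw 2 [← sum_coeff_smul_root b x]
  rw [map_sum]
  refine sum_eq_zero fun i _ => ?_
  rw [map_smul, hsymm, h1, smul_zero]

/-- A vector fixed by a bipartite Coxeter element vanishes. -/
lemma eq_zero_of_colourRefl_mul_smul_eq {s : ℤˣ} {x : M}
    (h : (colourRefl b ε (-s) * colourRefl b ε s) • x = x) : x = 0 := by
  -- Each side changes only the coefficients of its own colour, so neither changes any, and all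
  -- coroots vanish on `x`.
  have h1 : colourRefl b ε s • x = colourRefl b ε (-s) • x := by
    conv_rhs => rw [← h]
    rw [smul_smul, ← mul_assoc, colourRefl_mul_self, one_mul]
  refine eq_zero_of_sum_cartan_eq_zero b fun i => ?_
  have h2 := congrArg (coeff b · i) h1
  simp only [coeff_colourRefl_smul] at h2
  by_cases hi : ε i = s
  · rw [if_pos hi, if_neg (by rw [hi]; exact units_ne_neg s)] at h2
    linarith
  · rw [if_neg hi, if_pos (units_eq_neg_of_ne hi)] at h2
    linarith

/-- A root that stayed positive forever would, summed over the powers of a bipartite Coxeter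
element, give a nonzero fixed vector. -/
lemma exists_not_isPosRoot_altProd_smul {x : M} (hx : IsPosRoot b x) (s : ℤˣ) :
    ∃ k, ¬ IsPosRoot b (altProd (colourRefl b ε) s k • x) := by
  by_contra! hpos
  set g := colourRefl b ε (-s) * colourRefl b ε s with hg
  have hn := orderOf_pos g
  have hfix : g • ∑ m ∈ range (orderOf g), g ^ m • x = ∑ m ∈ range (orderOf g), g ^ m • x := by
    have h1 := sum_range_succ (fun m => g ^ m • x) (orderOf g)
    rw [sum_range_succ', pow_orderOf_eq_one, pow_zero, add_left_inj] at h1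
    rw [weyl_smul_sum, ← h1]
    exact sum_congr rfl fun m _ => by rw [smul_smul, pow_succ']
  have h0 := eq_zero_of_colourRefl_mul_smul_eq b ε hfix
  obtain ⟨i, hi⟩ := hx.exists_coeff_pos
  have h1 : 0 < coeff b (∑ m ∈ range (orderOf g), g ^ m • x) i := by
    rw [coeff_sum]
    refine sum_pos' (fun m _ => ?_) ⟨0, by simpa using hn, by simpa using hi⟩
    rw [hg, ← altProd_two_mul]
    exact (hpos _).coeff_nonneg i
  rw [h0, coeff_zero] at h1
  exact h1.false

/-- Applying reflections of alternating colours, starting with the colour `s`, to the positive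
root `x`, one first leaves the positive roots after `n` steps, at the negative simple root with
index `j`. -/
structure Exits (s : ℤˣ) (x : M) (n : ℕ) (j : b.support) : Prop where
  isPosRoot : ∀ m < n, IsPosRoot b (altProd (colourRefl b ε) s m • x)
  smul_eq : altProd (colourRefl b ε) s n • x = -P.root j
  colour : ε j = -s * (-1) ^ n

lemma exists_exits [P.IsReduced] {x : M} (hx : IsPosRoot b x) (s : ℤˣ) :
    ∃ n j, Exits b ε s x n j := by
  classical
  have hex := exists_not_isPosRoot_altProd_smul b ε hx s
  obtain ⟨n, hn⟩ : ∃ n, Nat.find hex = n + 1 := by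
    refine Nat.exists_eq_succ_of_ne_zero fun h => ?_
    have := Nat.find_spec hex
    rw [h, altProd_zero, one_smul] at this
    exact this hx
  have hlt (m : ℕ) (hm : m < n + 1) : IsPosRoot b (altProd (colourRefl b ε) s m • x) := by
    by_contra hc
    exact Nat.find_min hex (hn ▸ hm) hc
  have hns := Nat.find_spec hex
  rw [hn, altProd_succ, mul_smul] at hns
  obtain ⟨j, hj, hj'⟩ := exists_eq_simple_of_not_isPosRoot b ε (hlt n (by omega)) hns
  refine ⟨n + 1, j, hlt, ?_, ?_⟩
  · rw [altProd_succ, mul_smul, hj', colourRefl_smul_root b ε hj]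
  · rw [hj, pow_succ]; simp

/-- The walk from `j`, taken one step further than the exit of the walk from `i`, is at a vector `y`
whose coefficient at `i'` can be read off from the invariant Euler form. It is negative because `i`
and `j` are adjacent, so the walk from `j` cannot still be positive. -/
lemma exits_le_of_adj {i j i' j' : b.support} {n m : ℕ} (hij : (coxeterGraph b).Adj i j)
    (hi : Exits b ε (-ε i) (P.root i) n i') (hj : Exits b ε (-ε j) (P.root j) m j') :
    m ≤ n := by
  by_contra! hnm
  obtain ⟨d, hd0, hd⟩ := exists_symmetrizer b
  obtain ⟨σ, hσ⟩ : ∃ σ, ε i = σ := ⟨_, rfl⟩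
  have hεj : ε j = -σ := units_eq_neg_of_ne fun h => ε.valid hij (hσ.trans h.symm)
  have hi' : ε i' = σ * (-1) ^ n := by rw [hi.colour, hσ, neg_neg]
  rw [hσ] at hi
  rw [hεj, neg_neg] at hj
  set y := altProd (colourRefl b ε) σ (n + 1) • P.root j with hy
  have hy' : y = altProd (colourRefl b ε) (-σ) n • (colourRefl b ε σ • P.root j) := by
    rw [hy, altProd_succ', mul_smul]
  -- Both orientations `s` are needed: one gives the sign of the coefficient, the other settles the
  -- borderline case `m = n + 1`.
  have hstart (s : ℤˣ) :
      eulerForm b ε d (s * (-1) ^ n) (P.root i') y = eulerForm b ε d s (P.root j) (P.root i) := by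
    have h := eulerForm_altProd_smul b ε hd s (-σ) n (P.root i) (colourRefl b ε σ • P.root j)
    have h' := eulerForm_colourRefl_smul b ε hd s σ (-P.root i) (P.root j)
    rw [← hy', hi.smul_eq, eulerForm_neg_left] at h
    rw [weyl_smul_neg, colourRefl_smul_root b ε hσ, neg_neg, ← h, eulerForm_neg_right b ε hd] at h'
    linarith
  have h1 : eulerForm b ε d (-σ * (-1) ^ n) (P.root i') y = d i * cartan b i j := by
    rw [hstart (-σ), eulerForm_swap b ε hd, neg_neg, eulerForm_root_root b ε hd hσ hεj]
  have h2 : eulerForm b ε d (σ * (-1) ^ n) (P.root i') y = 0 := by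
    rw [hstart σ, eulerForm_root_left b ε hεj, coeff_root_simple, if_neg hij.1, mul_zero]
  rw [eulerForm_root_left b ε (by rw [hi']; simp)] at h1
  have h3 : coeff b y i' < 0 := by
    have h4 := mul_neg_of_pos_of_neg (hd0 i) (cartan_neg_of_adj b hij)
    rw [← h1] at h4
    exact (pos_iff_neg_of_mul_neg h4).mp (hd0 i')
  rcases Nat.lt_or_ge (n + 1) m with hlt | hge
  · exact not_isPosRoot_of_coeff_neg h3 (hj.isPosRoot _ hlt)
  -- Here `y` is the negative simple root of `j'`, and its negative coefficient forces `j' = i'`;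
  -- but then the form in the other orientation could not vanish.
  · obtain rfl : m = n + 1 := le_antisymm hge hnm
    have hyj : y = -P.root j' := hj.smul_eq
    have hj' : ε j' = σ * (-1) ^ n := by rw [hj.colour, pow_succ]; simp
    rw [eulerForm_swap b ε hd, hyj, eulerForm_neg_left,
      eulerForm_root_left b ε (by rw [hj', neg_neg]), neg_eq_zero,
      coeff_root_simple] at h2
    rw [hyj, coeff_neg, coeff_root_simple] at h3
    by_cases hij' : i' = j'
    · rw [if_pos hij', mul_one] at h2
      exact (hd0 j').ne' h2
    · rw [if_neg (Ne.symm hij')] at h3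
      simp at h3

end Walk

/-! ### The common exit time: the longest element and the Coxeter number. -/

section CoxeterNumber

variable [Finite ι] [P.IsCrystallographic] [P.IsRootSystem] [P.IsReduced] (b : P.Base)
  (ε : (coxeterGraph b).Coloring ℤˣ)

/-- Starting from any simple root, one leaves the positive roots after exactly `h` alternating
reflections; `f` records at which negative simple root. -/
def UniformExit (h : ℕ) (f : b.support → b.support) : Prop :=
  ∀ i, Exits b ε (-ε i) (P.root i) h (f i)

lemma eq_or_adj_of_cartanMatrix_ne_zero {i j : b.support} (h : b.cartanMatrix j i ≠ 0) :
    i = j ∨ (coxeterGraph b).Adj i j := by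
  by_cases hij : i = j
  · exact Or.inl hij
  have h0 : P.pairing j i ≠ 0 := fun h0 =>
    h ((b.cartanMatrix_apply_eq_zero_iff_pairing).mpr h0)
  exact Or.inr ⟨hij, mul_pos_of_neg_of_neg (lt_of_le_of_ne (cartan_nonpos b hij) h0)
    (lt_of_le_of_ne (cartan_nonpos b (Ne.symm hij)) fun h1 => h0 (P.pairing_eq_zero_iff.mp h1))⟩

lemma exists_uniformExit [P.IsIrreducible] : ∃ h f, UniformExit b ε h f := by
  choose n f hnf using fun i : b.support =>
    exists_exits b ε (isPosRoot_simple b i) (-ε i)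
  rcases isEmpty_or_nonempty b.support with he | ⟨⟨i⟩⟩
  · exact ⟨0, f, fun i => (he.false i).elim⟩
  refine ⟨n i, f, fun j => ?_⟩
  suffices n j = n i from this ▸ hnf j
  refine b.induction_on_cartanMatrix (fun k => n k = n i) (i := i) (j := j) rfl fun k l hk hkl => ?_
  rcases eq_or_adj_of_cartanMatrix_ne_zero b hkl with rfl | hadj
  · exact hk
  · exact (le_antisymm (exits_le_of_adj b ε hadj (hnf k) (hnf l))
      (exits_le_of_adj b ε hadj.symm (hnf l) (hnf k))).trans hk

variable {b ε} {h : ℕ} {f : b.support → b.support} (hf : UniformExit b ε h f)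

include hf

lemma UniformExit.colour (i : b.support) : ε (f i) = ε i * (-1) ^ h := by
  rw [(hf i).colour, neg_neg]

lemma UniformExit.ne_zero (i : b.support) : h ≠ 0 := by
  rintro rfl
  have h1 := (hf i).smul_eq
  rw [altProd_zero, one_smul] at h1
  have h2 := (isPosRoot_simple b i).not_neg
  rw [h1, neg_neg] at h2
  exact h2 (isPosRoot_simple b (f i))

/-- The definition covers `s = -ε i`. For the other sign, a first reflection that negates the root
of `i` is added and the final one, which negates the root of `f i`, is dropped. -/
lemma UniformExit.altProd_smul_root (s : ℤˣ) (i : b.support) :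
    altProd (colourRefl b ε) s h • P.root i = -P.root (f i) := by
  by_cases hs : s = -ε i
  · rw [hs, (hf i).smul_eq]
  · obtain rfl : s = ε i := by rw [units_eq_neg_of_ne hs, neg_neg]
    obtain ⟨k, rfl⟩ := Nat.exists_eq_succ_of_ne_zero (hf.ne_zero i)
    have h1 := (hf i).smul_eq
    have h2 : colourRefl b ε (-ε i * (-1) ^ k) • P.root (f i) = -P.root (f i) :=
      colourRefl_smul_root b ε (by rw [hf.colour, pow_succ]; simp)
    rw [Nat.succ_eq_add_one, altProd_succ, mul_smul, ← h2] at h1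
    rw [Nat.succ_eq_add_one, altProd_succ', mul_smul, colourRefl_smul_root b ε rfl,
      weyl_smul_neg, smul_left_cancel _ h1]

lemma UniformExit.eq_longest {w₀ : P.weylGroup} (hw₀ : IsLongest b w₀) (s : ℤˣ) :
    altProd (colourRefl b ε) s h = w₀ := by
  refine eq_of_not_isPosRoot (fun i => ?_) hw₀.not_isPosRoot
  rw [hf.altProd_smul_root]
  exact (isPosRoot_simple b (f i)).not_neg

lemma UniformExit.longest_smul_root {w₀ : P.weylGroup} (hw₀ : IsLongest b w₀) (i : b.support) :
    w₀ • P.root i = -P.root (f i) := by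
  rw [← hf.eq_longest hw₀ 1, hf.altProd_smul_root]

lemma UniformExit.altProd_mul_altProd (s r : ℤˣ) :
    altProd (colourRefl b ε) s h * altProd (colourRefl b ε) r h = 1 := by
  refine eq_one_of_isPosRoot (b := b) fun i => ?_
  rw [mul_smul, hf.altProd_smul_root, weyl_smul_neg, hf.altProd_smul_root, neg_neg]
  exact isPosRoot_simple b _

lemma UniformExit.involutive : Function.Involutive f := fun i => by
  have h1 := congrArg (· • P.root i) (hf.altProd_mul_altProd 1 1)
  simp only [mul_smul, one_smul, hf.altProd_smul_root, weyl_smul_neg, neg_neg] at h1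
  exact root_simple_injective b h1

lemma UniformExit.longest_mul_self {w₀ : P.weylGroup} (hw₀ : IsLongest b w₀) : w₀ * w₀ = 1 := by
  have h1 := hf.altProd_mul_altProd 1 1
  rwa [hf.eq_longest hw₀] at h1

lemma UniformExit.isNegOne_iff {w₀ : P.weylGroup} (hw₀ : IsLongest b w₀) :
    IsNegOne w₀ ↔ ∀ i, f i = i := by
  refine ⟨fun hn i => ?_, fun hi x => ?_⟩
  · have h1 := hf.longest_smul_root hw₀ i
    rw [hn, neg_inj] at h1
    exact (root_simple_injective b h1).symm
  · rw [← sum_coeff_smul_root b x, weyl_smul_sum, ← sum_neg_distrib]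
    refine sum_congr rfl fun i _ => ?_
    rw [weyl_smul_smul, hf.longest_smul_root hw₀, hi, smul_neg]

lemma UniformExit.orderOf_eq_aux (i : b.support) :
    orderOf (colourRefl b ε (- -ε i) * colourRefl b ε (-ε i)) = h := by
  set g := colourRefl b ε (- -ε i) * colourRefl b ε (-ε i) with hg
  have hgh : g ^ h = 1 := by
    rw [hg, ← altProd_two_mul, two_mul, altProd_add, hf.altProd_mul_altProd]
  obtain ⟨q, hq⟩ := orderOf_dvd_of_pow_eq_one hgh
  have hh := hf.ne_zero i
  by_contra hne
  have hq0 : q ≠ 0 := by rintro rfl; simp at hq; omega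
  have hq1 : q ≠ 1 := by rintro rfl; simp at hq; omega
  -- If the order were a proper divisor of `h`, some even power-length would fall in `[h, 2 * h)`.
  -- There the walk has passed its exit and continues as minus a still positive walk from `f i`, so
  -- it cannot have returned to the root of `i`.
  obtain ⟨l, e, hle, he⟩ : ∃ l e, 2 * (orderOf g * l) = e + h ∧ e < h := by
    rcases Nat.even_or_odd' q with ⟨l, rfl | rfl⟩
    · exact ⟨l, 0, by rw [hq]; ring, by omega⟩
    · refine ⟨l + 1, orderOf g, by linarith, ?_⟩
      have : 0 < orderOf g := orderOf_pos g
      have : 1 ≤ l := by omega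
      nlinarith
  have h1 : altProd (colourRefl b ε) (-ε i) (e + h) = 1 := by
    rw [← hle, altProd_two_mul, ← hg, pow_mul, pow_orderOf_eq_one, one_pow]
  have h2 := congrArg (· • P.root i) h1
  simp only [altProd_add, mul_smul, one_smul, hf.altProd_smul_root, weyl_smul_neg] at h2
  have h3 := (hf (f i)).isPosRoot e he
  rw [hf.colour, ← neg_mul] at h3
  apply h3.not_neg
  rw [h2]
  exact isPosRoot_simple b i

lemma UniformExit.orderOf_coxeterElement [Nonempty b.support] {c : P.weylGroup}
    (hc : IsCoxeterElement b c) : orderOf c = h := by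
  classical
  obtain ⟨i⟩ := ‹Nonempty b.support›
  rw [← hf.orderOf_eq_aux i]
  refine orderOf_eq_of_isConj (hc.isConj ?_)
  refine ⟨_, ?_, ?_, (wordProd_append b _ _).symm⟩
  · refine List.Nodup.append (Finset.nodup_toList _) (Finset.nodup_toList _) ?_
    intro j hj hj'
    simp only [mem_toList, mem_filter, mem_univ, true_and] at hj hj'
    exact units_ne_neg (-ε i) (hj'.symm.trans hj)
  · intro j
    simp only [List.mem_append, mem_toList, mem_filter, mem_univ, true_and]
    by_cases hj : ε j = -ε i
    · exact Or.inr hj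
    · exact Or.inl (units_eq_neg_of_ne hj)

end CoxeterNumber

/-! ### Groups generated by two involutions. -/

section Dihedral

variable {G : Type*} [Group G] {a c : G}

/-- The homomorphism from a dihedral group defined by two involutions. -/
def dihedralHom (ha : a * a = 1) (hc : c * c = 1) [NeZero (orderOf (a * c))] :
    DihedralGroup (orderOf (a * c)) →* G :=
  have hadd (i j : ZMod (orderOf (a * c))) :
      (a * c) ^ (i + j).val = (a * c) ^ i.val * (a * c) ^ j.val := by
    rw [ZMod.val_add, pow_mod_orderOf, pow_add]
  have hsub (i j : ZMod (orderOf (a * c))) :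
      (a * c) ^ (j - i).val = ((a * c) ^ i.val)⁻¹ * (a * c) ^ j.val := by
    rw [eq_inv_mul_iff_mul_eq, ← hadd, add_sub_cancel]
  have hconj (k : ℕ) : a * (a * c) ^ k * a = ((a * c) ^ k)⁻¹ := by
    have ha' : a⁻¹ = a := inv_eq_of_mul_eq_one_left ha
    have hc' : c⁻¹ = c := inv_eq_of_mul_eq_one_left hc
    have h1 : a * (a * c) * a⁻¹ = (a * c)⁻¹ := by
      rw [mul_inv_rev, ha', hc', ← mul_assoc, ha, one_mul]
    nth_rw 3 [← ha']
    rw [← conj_pow, h1, inv_pow]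
  { toFun := fun
      | .r i => (a * c) ^ i.val
      | .sr i => a * (a * c) ^ i.val
    map_one' := by
      change (a * c) ^ (0 : ZMod _).val = 1
      simp
    map_mul' := by
      have hcomm (k : ℕ) : (a * c) ^ k * a = a * ((a * c) ^ k)⁻¹ := by
        rw [← hconj, ← mul_assoc, ← mul_assoc, ha, one_mul]
      rintro (i | i) (j | j)
      · exact hadd i j
      · change a * (a * c) ^ (j - i).val = (a * c) ^ i.val * (a * (a * c) ^ j.val)
        rw [hsub, ← mul_assoc, ← mul_assoc, hcomm]
      · change a * (a * c) ^ (i + j).val = a * (a * c) ^ i.val * (a * c) ^ j.val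
        rw [hadd, mul_assoc]
      · change (a * c) ^ (j - i).val = a * (a * c) ^ i.val * (a * (a * c) ^ j.val)
        rw [hsub, ← hconj, mul_assoc (a * (a * c) ^ i.val)] }

/-- A group generated by two involutions is dihedral. -/
lemma nonempty_closure_pair_mulEquiv_dihedralGroup (ha : a * a = 1) (hc : c * c = 1)
    (h0 : orderOf (a * c) ≠ 0) (hac : a * c ≠ c * a) :
    Nonempty (Subgroup.closure {a, c} ≃* DihedralGroup (orderOf (a * c))) := by
  have : NeZero (orderOf (a * c)) := ⟨h0⟩
  have hr (i : ZMod (orderOf (a * c))) : dihedralHom ha hc (.r i) = (a * c) ^ i.val := rfl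
  have hsr (i : ZMod (orderOf (a * c))) : dihedralHom ha hc (.sr i) = a * (a * c) ^ i.val := rfl
  have hinj : Function.Injective (dihedralHom ha hc) := by
    rw [injective_iff_map_eq_one]
    rintro (i | i) hi
    · rw [hr] at hi
      have h1 := Nat.eq_zero_of_dvd_of_lt (orderOf_dvd_of_pow_eq_one hi) (ZMod.val_lt i)
      rw [(ZMod.val_eq_zero i).mp h1, DihedralGroup.one_def]
    · rw [hsr] at hi
      -- A reflection in the kernel makes `a` the inverse of a power of `a * c`, so `a` and `c`
      -- would commute.
      have hcomm : Commute a (a * c) := by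
        have h1 : Commute ((a * c) ^ i.val)⁻¹ (a * c) :=
          ((Commute.refl (a * c)).pow_left _).inv_left
        rwa [← eq_inv_of_mul_eq_one_left hi] at h1
      refine absurd ?_ hac
      have h2 := hcomm.eq
      rw [mul_assoc] at h2
      rw [mul_left_cancel h2]
  have hrange : (dihedralHom ha hc).range = Subgroup.closure {a, c} := by
    apply le_antisymm
    · rintro _ ⟨x, rfl⟩
      have ha' : a ∈ Subgroup.closure {a, c} := Subgroup.subset_closure (by simp)
      have hc' : c ∈ Subgroup.closure {a, c} := Subgroup.subset_closure (by simp)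
      rcases x with i | i
      · exact pow_mem (mul_mem ha' hc') _
      · exact mul_mem ha' (pow_mem (mul_mem ha' hc') _)
    · rw [Subgroup.closure_le]
      rintro x (rfl | rfl)
      · exact ⟨.sr 0, by simp [hsr]⟩
      · refine ⟨.sr 1, ?_⟩
        rw [hsr, ZMod.val_one_eq_one_mod, pow_mod_orderOf, pow_one, ← mul_assoc, ha, one_mul]
  exact ⟨((MulEquiv.subgroupCongr hrange.symm).trans
    (MonoidHom.ofInjective hinj).symm)⟩

end Dihedral

/-! ### Orbits under a group generated by involutions. -/

section Orbits

variable {G X : Type*} [Group G] [MulAction G X]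

/-- The orbit of a group generated by involutions is contained in any set stable under them. -/
lemma orbit_closure_subset {A : Set G} (hA : ∀ a ∈ A, a * a = 1) {S : Set X}
    (hS : ∀ a ∈ A, ∀ x ∈ S, a • x ∈ S) {x : X} (hx : x ∈ S) :
    MulAction.orbit (Subgroup.closure A) x ⊆ S := by
  rintro _ ⟨⟨g, hg⟩, rfl⟩
  change g • x ∈ S
  -- The equivalence, available because the generators are involutions, is what passes to inverses.
  have key : ∀ y, y ∈ S ↔ g • y ∈ S := by
    clear hx
    induction hg using Subgroup.closure_induction with
    | mem a ha =>
      refine fun y => ⟨hS a ha y, fun hy => ?_⟩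
      have h1 := hS a ha _ hy
      rwa [smul_smul, hA a ha, one_smul] at h1
    | one => simp
    | mul g g' _ _ ih ih' => intro y; rw [ih', ih, mul_smul]
    | inv g _ ih => intro y; rw [ih (g⁻¹ • y), smul_inv_smul]
  exact (key x).mp hx

end Orbits

/-! ### The involutions `τ_±` on almost positive roots: orbits and orders. -/

section Tau

variable [Finite ι] [P.IsCrystallographic] [P.IsRootSystem] [P.IsReduced] {b : P.Base}
  {ε : (coxeterGraph b).Coloring ℤˣ}

lemma tau_eq_colourRefl_smul {x : M} (hx : IsPosRoot b x) (s : ℤˣ) :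
    tau b ε s x = colourRefl b ε s • x := by
  classical
  refine coeff_ext b fun i => ?_
  rw [tau_eq, coeff_tauOn, coeff_colourRefl_smul]
  simp only [mem_filter, mem_univ, true_and]
  split_ifs with hi
  · rw [← add_sum_erase univ _ (mem_univ i), cartan_self,
      sum_congr rfl fun j _ => by rw [max_eq_left (hx.coeff_nonneg j)]]
    ring
  · rfl

lemma tau_neg_root (s : ℤˣ) (i : b.support) :
    tau b ε s (-P.root i) = if ε i = s then P.root i else -P.root i := by
  classical
  refine coeff_ext b fun j => ?_
  have hmax (k : b.support) : max (coeff b (-P.root i) k) 0 = 0 := by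
    rw [coeff_negSimple]; split_ifs <;> simp
  rw [tau_eq, coeff_tauOn]
  simp only [mem_filter, mem_univ, true_and, hmax, mul_zero, sum_const_zero, sub_zero]
  by_cases hij : i = j
  · subst hij
    split_ifs <;> simp [coeff_neg]
  · split_ifs <;> simp [coeff_neg, coeff_root_simple, hij]

variable (b) in
/-- The negative simple root with index `i`, as an element of `Φ_{≥ -1}`. -/
def negRoot (i : b.support) : almostPos b := ⟨-P.root i, Or.inr ⟨i, i.2, rfl⟩⟩

lemma negRoot_injective : Function.Injective (negRoot b) := fun _ _ h =>
  root_simple_injective b (neg_injective (congrArg Subtype.val h))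

lemma exists_eq_negRoot {x : almostPos b} (hx : (x : M) ∈ negSimple b) :
    ∃ i, x = negRoot b i := by
  obtain ⟨i, hi, hxi⟩ := hx
  exact ⟨⟨i, hi⟩, Subtype.ext hxi⟩

lemma IsPosRoot.notMem_negSimple {x : M} (hx : IsPosRoot b x) : x ∉ negSimple b := by
  rintro ⟨i, hi, rfl⟩
  exact (isPosRoot_simple b ⟨i, hi⟩).not_neg hx

lemma tauPerm_mul_self (s : ℤˣ) : tauPerm b ε s * tauPerm b ε s = 1 :=
  Equiv.ext fun x => Subtype.ext (tau_tau b ε s x)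

lemma tauPerm_tauPerm (s : ℤˣ) (x : almostPos b) : tauPerm b ε s (tauPerm b ε s x) = x :=
  Subtype.ext (tau_tau b ε s x)

lemma tauPerm_negRoot_of_ne {s : ℤˣ} {i : b.support} (h : ε i ≠ s) :
    tauPerm b ε s (negRoot b i) = negRoot b i :=
  Subtype.ext ((tau_neg_root s i).trans (if_neg h))

lemma coe_tauPerm_negRoot {i : b.support} : (tauPerm b ε (ε i) (negRoot b i) : M) = P.root i :=
  (tau_neg_root _ i).trans (if_pos rfl)

lemma tauPerm_mem_D (s : ℤˣ) : tauPerm b ε s ∈ D b ε := by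
  refine Subgroup.subset_closure ?_
  rcases Int.units_eq_one_or s with rfl | rfl <;> simp

lemma altProd_tauPerm_mem_D (s : ℤˣ) (k : ℕ) : altProd (tauPerm b ε) s k ∈ D b ε := by
  induction k with
  | zero => exact one_mem _
  | succ k ih => exact mul_mem (tauPerm_mem_D _) ih

lemma Exits.coe_altProd_tauPerm {s : ℤˣ} {x : almostPos b} {n : ℕ} {j : b.support}
    (h : Exits b ε s x n j) {m : ℕ} (hm : m ≤ n) :
    (altProd (tauPerm b ε) s m x : M) = altProd (colourRefl b ε) s m • (x : M) := by
  induction m with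
  | zero => simp
  | succ m ih =>
    have ih' := ih (by omega)
    rw [altProd_succ, altProd_succ, mul_smul, ← ih']
    refine tau_eq_colourRefl_smul ?_ _
    rw [ih']
    exact h.isPosRoot m (by omega)

lemma orbit_D_subset {S : Set (almostPos b)} (hS : ∀ s, ∀ x ∈ S, tauPerm b ε s x ∈ S)
    {x : almostPos b} (hx : x ∈ S) : MulAction.orbit (D b ε) x ⊆ S :=
  orbit_closure_subset (by rintro a (rfl | rfl) <;> exact tauPerm_mul_self _)
    (by rintro a (rfl | rfl) y hy <;> exact hS _ y hy) hx

lemma smul_mem_orbit_D {g : Equiv.Perm (almostPos b)} (hg : g ∈ D b ε) (x : almostPos b) :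
    g x ∈ MulAction.orbit (D b ε) x :=
  ⟨⟨g, hg⟩, rfl⟩

variable (ε) in
/-- Every orbit of `D` contains a negative simple root. -/
lemma exists_negRoot_mem_orbit (x : almostPos b) :
    ∃ i, negRoot b i ∈ MulAction.orbit (D b ε) x := by
  rcases x.2 with hx | hx
  · obtain ⟨n, j, hnj⟩ := exists_exits b ε (x := (x : M)) hx 1
    refine ⟨j, ?_⟩
    have h1 : altProd (tauPerm b ε) 1 n x = negRoot b j :=
      Subtype.ext ((hnj.coe_altProd_tauPerm le_rfl).trans hnj.smul_eq)
    rw [← h1]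
    exact smul_mem_orbit_D (altProd_tauPerm_mem_D 1 n) x
  · obtain ⟨i, rfl⟩ := exists_eq_negRoot hx
    exact ⟨i, MulAction.mem_orbit_self _⟩

/-- Each `τ_r` inverts `τ₋ₛ τₛ` by conjugation, so the fixed points of a power form a `D`-stable
set, and every orbit meets `-Π`. -/
lemma tauPerm_mul_pow_eq_one {s : ℤˣ} {m : ℕ}
    (h : ∀ i, ((tauPerm b ε (-s) * tauPerm b ε s) ^ m) (negRoot b i) = negRoot b i) :
    (tauPerm b ε (-s) * tauPerm b ε s) ^ m = 1 := by
  set p := tauPerm b ε (-s) * tauPerm b ε s with hp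
  have hinv (s : ℤˣ) : (tauPerm b ε s)⁻¹ = tauPerm b ε s :=
    inv_eq_of_mul_eq_one_left (tauPerm_mul_self s)
  have hconj (r : ℤˣ) : tauPerm b ε r * p * (tauPerm b ε r)⁻¹ = p⁻¹ := by
    by_cases hr : r = s
    · rw [hr, hp, mul_inv_rev, hinv, hinv, mul_assoc, mul_assoc, tauPerm_mul_self, mul_one]
    · rw [units_eq_neg_of_ne hr, hp, mul_inv_rev, hinv, hinv, ← mul_assoc, tauPerm_mul_self,
        one_mul]
  refine Equiv.ext fun x => ?_
  obtain ⟨i, hi⟩ := exists_negRoot_mem_orbit ε x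
  refine orbit_D_subset (S := {y | (p ^ m) y = y}) (fun r y hy => ?_) (h i)
    (MulAction.mem_orbit_symm.mp hi)
  have h1 : p ^ m * tauPerm b ε r = tauPerm b ε r * (p ^ m)⁻¹ := by
    rw [← inv_pow, ← hconj r, conj_pow, hinv, ← mul_assoc, ← mul_assoc, tauPerm_mul_self, one_mul]
  have h2 := congrArg (· y) h1
  simp only [Equiv.Perm.mul_apply] at h2
  rw [Set.mem_ofPred_eq, h2, Equiv.Perm.inv_eq_iff_eq.mpr (Eq.symm hy)]

variable {h : ℕ} {f : b.support → b.support} (hf : UniformExit b ε h f)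

include hf

lemma UniformExit.coe_altProd_tauPerm_negRoot (i : b.support) {m : ℕ} (hm : m ≤ h) :
    (altProd (tauPerm b ε) (ε i) (m + 1) (negRoot b i) : M) =
      altProd (colourRefl b ε) (-ε i) m • P.root i := by
  rw [altProd_succ', Equiv.Perm.mul_apply]
  have h1 := hf i
  rw [← coe_tauPerm_negRoot (ε := ε) (i := i)] at h1 ⊢
  exact h1.coe_altProd_tauPerm hm

lemma UniformExit.isPosRoot_altProd_tauPerm (i : b.support) {m : ℕ} (h0 : m ≠ 0) (hm : m ≤ h) :
    IsPosRoot b (altProd (tauPerm b ε) (ε i) m (negRoot b i) : M) := by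
  obtain ⟨k, rfl⟩ := Nat.exists_eq_succ_of_ne_zero h0
  rw [Nat.succ_eq_add_one, hf.coe_altProd_tauPerm_negRoot i (by omega)]
  exact (hf i).isPosRoot k (by omega)

lemma UniformExit.altProd_tauPerm_succ (i : b.support) :
    altProd (tauPerm b ε) (ε i) (h + 1) (negRoot b i) = negRoot b (f i) :=
  Subtype.ext ((hf.coe_altProd_tauPerm_negRoot i le_rfl).trans (hf i).smul_eq)

/-- Traversing the path takes `h + 1` steps; the extra step is idle, at the far end if `s = ε i` and
at the near end otherwise. Hence the result does not depend on `s`. -/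
lemma UniformExit.altProd_tauPerm_add_two (s : ℤˣ) (i : b.support) :
    altProd (tauPerm b ε) s (h + 2) (negRoot b i) = negRoot b (f i) := by
  by_cases hs : s = ε i
  · rw [hs, altProd_succ, Equiv.Perm.mul_apply, hf.altProd_tauPerm_succ, tauPerm_negRoot_of_ne]
    rw [hf.colour, pow_succ, mul_neg_one, mul_neg]
    exact units_ne_neg _
  · rw [altProd_succ', Equiv.Perm.mul_apply, tauPerm_negRoot_of_ne (Ne.symm hs),
      units_eq_neg_of_ne hs, neg_neg, hf.altProd_tauPerm_succ]

lemma UniformExit.pow_eq_one (s : ℤˣ) :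
    (tauPerm b ε (-s) * tauPerm b ε s) ^ (h + 2) = 1 := by
  refine tauPerm_mul_pow_eq_one fun i => ?_
  rw [← altProd_two_mul, two_mul, altProd_add, Equiv.Perm.mul_apply, hf.altProd_tauPerm_add_two,
    hf.altProd_tauPerm_add_two, hf.involutive]

/-- With this starting sign the first step is idle. If `2 * m < h + 2`, the remaining `2 * m - 1 ≤
h` steps end at a positive root instead of returning. -/
lemma UniformExit.le_two_mul {i : b.support} {m : ℕ} (hm0 : m ≠ 0)
    (hm : (tauPerm b ε (- -ε i) * tauPerm b ε (-ε i)) ^ m = 1) : h + 2 ≤ 2 * m := by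
  by_contra! hlt
  obtain ⟨k, hk⟩ : ∃ k, 2 * m = k + 1 := ⟨2 * m - 1, by omega⟩
  rw [← altProd_two_mul, hk, altProd_succ', neg_neg] at hm
  have h1 := congrArg (· (negRoot b i)) hm
  simp only [Equiv.Perm.mul_apply] at h1
  rw [tauPerm_negRoot_of_ne (units_ne_neg _)] at h1
  have h2 := hf.isPosRoot_altProd_tauPerm i (m := k) (by omega) (by omega)
  rw [h1] at h2
  exact (isPosRoot_simple b i).not_neg h2

lemma UniformExit.two_mul_orderOf_aux (hid : ∀ i, f i = i) (i : b.support) :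
    2 * orderOf (tauPerm b ε (- -ε i) * tauPerm b ε (-ε i)) = h + 2 := by
  -- An odd number of steps would make the colours of `i` and `f i` differ.
  have heven : Even h := by
    by_contra hodd
    have h1 := hf.colour i
    rw [hid, (Nat.not_even_iff_odd.mp hodd).neg_one_pow, mul_neg_one] at h1
    exact units_ne_neg _ h1
  obtain ⟨k, hk⟩ := heven
  have h1 : (tauPerm b ε (- -ε i) * tauPerm b ε (-ε i)) ^ (k + 1) = 1 := by
    refine tauPerm_mul_pow_eq_one fun j => ?_
    rw [← altProd_two_mul, show 2 * (k + 1) = h + 2 by omega, hf.altProd_tauPerm_add_two, hid]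
  have h2 := orderOf_pos_iff.mpr (isOfFinOrder_iff_pow_eq_one.mpr ⟨k + 1, by omega, h1⟩)
  have h3 := hf.le_two_mul h2.ne' (pow_orderOf_eq_one _)
  have h4 := Nat.le_of_dvd (by omega) (orderOf_dvd_of_pow_eq_one h1)
  omega

lemma UniformExit.orderOf_aux {i : b.support} (hi : f i ≠ i) :
    orderOf (tauPerm b ε (- -ε i) * tauPerm b ε (-ε i)) = h + 2 := by
  set p := tauPerm b ε (- -ε i) * tauPerm b ε (-ε i) with hp
  have h1 : p ^ (h + 2) = 1 := hf.pow_eq_one _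
  have h2 := orderOf_pos_iff.mpr (isOfFinOrder_iff_pow_eq_one.mpr ⟨h + 2, by omega, h1⟩)
  have h3 := hf.le_two_mul h2.ne' (pow_orderOf_eq_one _)
  obtain ⟨q, hq⟩ := orderOf_dvd_of_pow_eq_one h1
  have hq2 : q ≤ 2 := by
    by_contra! hlt
    nlinarith
  interval_cases q
  · omega
  · omega
  -- If the order were `(h + 2) / 2`, that power would be `h + 2` alternating steps, which move the
  -- negative root of `i` to that of `f i`.
  · exfalso
    have h4 := congrArg (· (negRoot b i)) (pow_orderOf_eq_one p)
    nth_rw 1 [hp] at h4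
    rw [← altProd_two_mul, mul_comm, ← hq, hf.altProd_tauPerm_add_two] at h4
    exact hi (negRoot_injective h4)

omit hf in
lemma orderOf_tauPerm_mul_tauPerm (s : ℤˣ) :
    orderOf (tauPerm b ε (-1) * tauPerm b ε 1) = orderOf (tauPerm b ε (-s) * tauPerm b ε s) := by
  have hinv (s : ℤˣ) : (tauPerm b ε s)⁻¹ = tauPerm b ε s :=
    inv_eq_of_mul_eq_one_left (tauPerm_mul_self s)
  rcases Int.units_eq_one_or s with rfl | rfl
  · rfl
  · rw [← orderOf_inv, mul_inv_rev, hinv, hinv, neg_neg]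

lemma UniformExit.two_mul_orderOf [Nonempty b.support] (hid : ∀ i, f i = i) :
    2 * orderOf (tauPerm b ε (-1) * tauPerm b ε 1) = h + 2 := by
  obtain ⟨i⟩ := ‹Nonempty b.support›
  rw [orderOf_tauPerm_mul_tauPerm (-ε i), hf.two_mul_orderOf_aux hid i]

lemma UniformExit.orderOf_eq (hid : ¬ ∀ i, f i = i) :
    orderOf (tauPerm b ε (-1) * tauPerm b ε 1) = h + 2 := by
  push Not at hid
  obtain ⟨i, hi⟩ := hid
  rw [orderOf_tauPerm_mul_tauPerm (-ε i), hf.orderOf_aux hi]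

/-- The `D`-orbit of a negative simple root is a path whose interior consists of positive
roots. -/
lemma UniformExit.orbit_subset (i : b.support) : MulAction.orbit (D b ε) (negRoot b i) ⊆
    {x | ∃ m ≤ h + 1, x = altProd (tauPerm b ε) (ε i) m (negRoot b i)} := by
  refine orbit_D_subset (fun s x hx => ?_) ⟨0, by omega, by simp⟩
  obtain ⟨m, hm, rfl⟩ := hx
  by_cases hs : s = ε i * (-1) ^ m
  · rcases hm.lt_or_eq with hlt | rfl
    · exact ⟨m + 1, hlt, by rw [hs, altProd_succ, Equiv.Perm.mul_apply]⟩
    · refine ⟨h + 1, le_rfl, ?_⟩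
      rw [hs, hf.altProd_tauPerm_succ, tauPerm_negRoot_of_ne]
      rw [hf.colour, pow_succ, mul_neg_one, mul_neg]
      exact units_ne_neg _
  · rcases m with _ | m
    · refine ⟨0, by omega, ?_⟩
      rw [altProd_zero, Equiv.Perm.one_apply, tauPerm_negRoot_of_ne]
      rintro rfl
      simp at hs
    · refine ⟨m, by omega, ?_⟩
      rw [altProd_succ, Equiv.Perm.mul_apply, units_eq_neg_of_ne hs, pow_succ, mul_neg_one,
        mul_neg, neg_neg, tauPerm_tauPerm]

lemma UniformExit.orbit_inter_negSimple (i : b.support) :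
    Subtype.val '' MulAction.orbit (D b ε) (negRoot b i) ∩ negSimple b =
      {-P.root i, -P.root (f i)} := by
  ext y
  simp only [Set.mem_inter_iff, Set.mem_insert_iff, Set.mem_singleton_iff]
  constructor
  · rintro ⟨⟨x, hx, rfl⟩, hy⟩
    obtain ⟨m, hm, rfl⟩ := hf.orbit_subset i hx
    rcases Nat.eq_zero_or_pos m with rfl | hm0
    · exact Or.inl rfl
    · rcases hm.lt_or_eq with hlt | rfl
      · exact absurd hy (hf.isPosRoot_altProd_tauPerm i hm0.ne' (by omega)).notMem_negSimple
      · rw [hf.altProd_tauPerm_succ]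
        exact Or.inr rfl
  · rintro (rfl | rfl)
    · exact ⟨⟨negRoot b i, MulAction.mem_orbit_self _, rfl⟩, i, i.2, rfl⟩
    · refine ⟨⟨negRoot b (f i), ?_, rfl⟩, f i, (f i).2, rfl⟩
      rw [← hf.altProd_tauPerm_succ]
      exact smul_mem_orbit_D (altProd_tauPerm_mem_D _ _) _

lemma UniformExit.orbit_negGroup {w₀ : P.weylGroup} (hw₀ : IsLongest b w₀) (i : b.support) :
    MulAction.orbit (negGroup w₀) (-P.root i) = {-P.root i, -P.root (f i)} := by
  have hg (x : M) : (LinearEquiv.neg ℝ * RootPairing.Equiv.weightHom P w₀ : M ≃ₗ[ℝ] M) x =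
      -(w₀ • x) := rfl
  have hgr (j : b.support) : (LinearEquiv.neg ℝ * RootPairing.Equiv.weightHom P w₀ : M ≃ₗ[ℝ] M)
      (-P.root j) = -P.root (f j) := by
    rw [hg, weyl_smul_neg, hf.longest_smul_root hw₀, neg_neg]
  apply Set.Subset.antisymm
  · rw [negGroup, Subgroup.zpowers_eq_closure]
    refine orbit_closure_subset ?_ ?_ (Set.mem_insert _ _)
    · rintro a rfl
      refine LinearEquiv.ext fun x => ?_
      rw [LinearEquiv.mul_apply, hg, hg, weyl_smul_neg, neg_neg, smul_smul,
        hf.longest_mul_self hw₀, one_smul]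
      rfl
    · rintro a rfl x (rfl | rfl)
      · exact Or.inr (hgr i)
      · refine Or.inl ((hgr (f i)).trans ?_)
        rw [hf.involutive]
  · rintro x (rfl | rfl)
    · exact MulAction.mem_orbit_self _
    · exact ⟨⟨_, Subgroup.mem_zpowers _⟩, hgr i⟩

omit hf in
lemma exists_adj [P.IsIrreducible] (hcard : 2 ≤ b.support.card) :
    ∃ i j, (coxeterGraph b).Adj i j := by
  obtain ⟨i, hi, j, hj, hij⟩ := Finset.one_lt_card.mp hcard
  by_contra! hcon
  refine hij (congrArg Subtype.val (b.induction_on_cartanMatrix (fun k => ⟨i, hi⟩ = k)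
    (i := ⟨i, hi⟩) (j := ⟨j, hj⟩) rfl fun k l hk hkl => ?_))
  rcases eq_or_adj_of_cartanMatrix_ne_zero b hkl with rfl | hadj
  · exact hk
  · exact absurd hadj (hcon _ _)

-- Let `i` and `j` be adjacent. If the involutions commuted, evaluation at `-αᵢ` would make the
-- reflection of colour `-ε i` fix `αᵢ`, but it changes the coefficient at `j`.
omit hf in
lemma tauPerm_mul_tauPerm_ne [P.IsIrreducible] (hcard : 2 ≤ b.support.card) :
    tauPerm b ε (-1) * tauPerm b ε 1 ≠ tauPerm b ε 1 * tauPerm b ε (-1) := by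
  classical
  intro hcomm
  obtain ⟨i, j, hij⟩ := exists_adj hcard
  have hcomm' : tauPerm b ε (-ε i) * tauPerm b ε (ε i) =
      tauPerm b ε (ε i) * tauPerm b ε (-ε i) := by
    rcases Int.units_eq_one_or (ε i) with hi | hi <;> rw [hi]
    · exact hcomm
    · rw [neg_neg]; exact hcomm.symm
  have h1 := congrArg (fun g => (g (negRoot b i) : M)) hcomm'
  simp only [Equiv.Perm.mul_apply] at h1
  rw [tauPerm_negRoot_of_ne (units_ne_neg _), coe_tauPerm_negRoot] at h1
  have h2 : colourRefl b ε (-ε i) • P.root i = P.root i := by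
    rw [← tau_eq_colourRefl_smul (isPosRoot_simple b i), ← coe_tauPerm_negRoot (ε := ε) (i := i)]
    exact h1.trans coe_tauPerm_negRoot.symm
  have h3 := coeff_colourRefl_smul b ε (-ε i) (P.root i) j
  rw [h2, if_pos (units_eq_neg_of_ne fun h => ε.valid hij h.symm)] at h3
  simp only [coeff_root_simple, mul_ite, mul_one, mul_zero, sum_ite_eq, mem_univ, if_true] at h3
  have h4 := cartan_neg_of_adj b hij.symm
  linarith

end Tau

end FZ

end

/-! ### The theorem. -/

theorem theorem2p6 {ι M N : Type*} [Finite ι] [AddCommGroup M] [Module ℝ M]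
    [AddCommGroup N] [Module ℝ N] (P : RootPairing ι ℝ M N)
    [P.IsRootSystem] [P.IsCrystallographic] [P.IsReduced] [P.IsIrreducible]
    (b : P.Base) (ε : (FZ.coxeterGraph b).Coloring ℤˣ)
    (c : P.weylGroup) (hc : FZ.IsCoxeterElement b c)
    (w₀ : P.weylGroup) (hw₀ : FZ.IsLongest b w₀) :
    -- every `D`-orbit meets `-Π`
    (∀ x : FZ.almostPos b,
      (Subtype.val '' MulAction.orbit (FZ.D b ε) x ∩ FZ.negSimple b).Nonempty) ∧
    -- `Ω ↦ Ω ∩ (-Π)` is a bijection from `D`-orbits in `Φ_{≥ -1}` to `⟨-w₀⟩`-orbits in `-Π`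
    Set.BijOn (fun Ω : Set (FZ.almostPos b) => Subtype.val '' Ω ∩ FZ.negSimple b)
      {Ω | ∃ x, Ω = MulAction.orbit (FZ.D b ε) x}
      {O : Set M | ∃ y ∈ FZ.negSimple b, O = MulAction.orbit (FZ.negGroup w₀) y} ∧
    -- the order of `τ₋ τ₊`, with the Coxeter number `h = orderOf c`
    (FZ.IsNegOne w₀ →
      2 * orderOf (FZ.tauPerm b ε (-1) * FZ.tauPerm b ε 1) = orderOf c + 2) ∧
    (¬ FZ.IsNegOne w₀ →
      orderOf (FZ.tauPerm b ε (-1) * FZ.tauPerm b ε 1) = orderOf c + 2) ∧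
    -- for rank at least two, `D` is dihedral of order `h + 2` or `2 (h + 2)`
    (2 ≤ b.support.card →
      (FZ.IsNegOne w₀ → Nat.card (FZ.D b ε) = orderOf c + 2 ∧
        Nonempty (FZ.D b ε ≃* DihedralGroup ((orderOf c + 2) / 2))) ∧
      (¬ FZ.IsNegOne w₀ → Nat.card (FZ.D b ε) = 2 * (orderOf c + 2) ∧
        Nonempty (FZ.D b ε ≃* DihedralGroup (orderOf c + 2)))) := by
  have : Nontrivial M := RootPairing.IsIrreducible.nontrivial P
  have : Nonempty ι := by
    by_contra hι
    rw [not_nonempty_iff] at hι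
    have h1 : P.rootSpan ℝ = ⊤ := by simp
    rw [RootPairing.rootSpan, Set.range_eq_empty, Submodule.span_empty] at h1
    exact bot_ne_top h1
  have : Nonempty b.support := b.support_nonempty.to_subtype
  obtain ⟨h, f, hf⟩ := FZ.exists_uniformExit b ε
  rw [hf.orderOf_coxeterElement hc, hf.isNegOne_iff hw₀]
  have hmeet (x : FZ.almostPos b) : ∃ i,
      MulAction.orbit (FZ.D b ε) x = MulAction.orbit (FZ.D b ε) (FZ.negRoot b i) := by
    obtain ⟨i, hi⟩ := FZ.exists_negRoot_mem_orbit ε x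
    exact ⟨i, (MulAction.orbit_eq_iff.mpr hi).symm⟩
  have hdihedral (hcard : 2 ≤ b.support.card)
      (h0 : orderOf (FZ.tauPerm b ε (-1) * FZ.tauPerm b ε 1) ≠ 0) :
      Nonempty (FZ.D b ε ≃*
        DihedralGroup (orderOf (FZ.tauPerm b ε (-1) * FZ.tauPerm b ε 1))) :=
    FZ.nonempty_closure_pair_mulEquiv_dihedralGroup (FZ.tauPerm_mul_self _)
      (FZ.tauPerm_mul_self _) h0 (FZ.tauPerm_mul_tauPerm_ne hcard)
  refine ⟨fun x => ?_, ⟨?_, ?_, ?_⟩, hf.two_mul_orderOf, hf.orderOf_eq,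
    fun hcard => ⟨fun hid => ?_, fun hid => ?_⟩⟩
  · obtain ⟨i, hi⟩ := hmeet x
    rw [hi, hf.orbit_inter_negSimple]
    exact Set.insert_nonempty _ _
  · rintro _ ⟨x, rfl⟩
    obtain ⟨i, hi⟩ := hmeet x
    refine ⟨-P.root i, ⟨i, i.2, rfl⟩, ?_⟩
    simp only [hi]
    rw [hf.orbit_inter_negSimple, hf.orbit_negGroup hw₀]
  · rintro _ ⟨x, rfl⟩ _ ⟨y, rfl⟩ hxy
    obtain ⟨i, hi⟩ := hmeet x
    -- Orbits with the same trace on `-Π` share a negative simple root, hence coincide.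
    have h1 : -P.root i ∈ Subtype.val '' MulAction.orbit (FZ.D b ε) x ∩ FZ.negSimple b := by
      rw [hi, hf.orbit_inter_negSimple]
      exact Set.mem_insert _ _
    have h2 : -P.root i ∈ Subtype.val '' MulAction.orbit (FZ.D b ε) y ∩ FZ.negSimple b :=
      (Set.ext_iff.mp hxy _).mp h1
    obtain ⟨z, hz, hzi⟩ := h2.1
    have h3 : z = FZ.negRoot b i := Subtype.ext hzi
    rw [hi, ← h3, MulAction.orbit_eq_iff.mpr hz]
  · rintro _ ⟨_, ⟨i, hi, rfl⟩, rfl⟩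
    exact ⟨_, ⟨FZ.negRoot b ⟨i, hi⟩, rfl⟩,
      (hf.orbit_inter_negSimple ⟨i, hi⟩).trans (hf.orbit_negGroup hw₀ ⟨i, hi⟩).symm⟩
  · have h1 := hf.two_mul_orderOf hid
    obtain ⟨e⟩ := hdihedral hcard (by omega)
    rw [← h1, Nat.mul_div_cancel_left _ two_pos]
    exact ⟨by rw [Nat.card_congr e.toEquiv, DihedralGroup.nat_card], ⟨e⟩⟩
  · have h1 := hf.orderOf_eq hid
    obtain ⟨e⟩ := hdihedral hcard (by omega)
    rw [← h1]
    exact ⟨by rw [Nat.card_congr e.toEquiv, DihedralGroup.nat_card], ⟨e⟩⟩
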